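/- **Scalable Nyquist Stability Criterion.** Let $\mathcal L\in\mathbb R^{n\times n}$ be the Laplacian matrix of a connected network with symmetric nonnegative line weights, and let $\mathcal G(s)=\mathrm{diag}(g_1(s),\dots,g_n(s))$, where each $g_i$ is a proper real transfer function: $g_i$ is meromorphic on a neighbourhood of the closed right half-plane, $g_i(\bar s)=\overline{g_i(s)}$, and $g_i$ is bounded near infinity in the closed right half-plane (for example, a proper real-rational function). Put $\Gamma=2\,\mathrm{diag}(\mathcal L_{11},\dots,\mathcal L_{nn})$ and $\mathcal G'(s)=\Gamma^{1/2}\mathcal G(s)\Gamma^{1/2}$, and let $\mathcal F(A)=\{v^{\mathsf H}Av: v\in\mathbb C^n,\ v^{\mathsf H}v=1\}$ denote the field of values. For $R,\varepsilon>0$ let $\mathcal D_{R,\varepsilon}$ be the Nyquist contour: the boundary of the right half-disc $\{\operatorname{Re}s>0,\ |s|<R\}$ with the closed $\varepsilon$-discs about the imaginary-axis poles of $\mathcal G'$ removed. Assume that $\mathcal G'(s)$ has no unstable poles (no poles with $\operatorname{Re}s>0$), and that the scaled field of values $\alpha\mathcal F(\mathcal G'(s))$, $\alpha\in(0,1]$,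 neither contains nor encircles $-1$ as $s$ goes around the Nyquist contour with an infinitely large semicircle and infinitely small indentations, that is: 1. for all sufficiently large $R$, all sufficiently small $\varepsilon>0$ and all $\alpha\in(0,1]$: $-1\notin\alpha\mathcal F(\mathcal G'(s))$ for every $s\in\mathcal D_{R,\varepsilon}$, and no closed curve obtained by choosing continuously a point of $\alpha\mathcal F(\mathcal G'(s))$ as $s$ goes once around $\mathcal D_{R,\varepsilon}$ has nonzero winding number about $-1$; 2. the distance from $-1$ to $\alpha\mathcal F(\mathcal G'(s))$ is bounded below by a positive constant, uniformly in $\alpha\in(0,1]$, for $s$ in the closed right half-plane with $|s|$ large enough, and likewise for $s$ in the closed right half-plane close enough to (and different from) any given imaginary-axis pole $p\neq0$ of $\mathcal G'$. Then the closed loop $\boldsymbol\delta=\mathcal G(s)(\boldsymbol d-\mathcal L\boldsymbol\delta)+\boldsymbol e$ achieves asymptotic synchronization on the average mode: $\det(I+\mathcal G(s)\mathcal L)$ is nonzero off a discrete subset of the closed right half-plane, and every interarea mode $v^{\mathsf T}\boldsymbol\delta$ ($v$ a real eigenvector of $\mathcal L$ for a nonzero eigenvalue) is stable, i.e. all entries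 of the transfer functions $v^{\mathsf T}(I+\mathcal G\mathcal L)^{-1}\mathcal G$ from $\boldsymbol d$ and $v^{\mathsf T}(I+\mathcal G\mathcal L)^{-1}$ from $\boldsymbol e$ to the mode are (after removal of removable singularities) analytic and bounded on the closed right half-plane. -/

import Mathlib

open scoped Matrix

namespace ScalableNyquist

noncomputable section

/-- The closed right half-plane. -/
def closedRHP : Set ℂ := {s | 0 ≤ s.re}

/-- `f` has a pole at `s`. -/
def IsPole (f : ℂ → ℂ) (s : ℂ) : Prop := meromorphicOrderAt f s < 0

/-- Proper real transfer functions: meromorphic on (a neighbourhood of) the closed right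
half-plane, in normal form (so that removable singularities are removed), real
(`f (conj s) = conj (f s)`), and bounded near infinity. For a reduced quotient `p / q` of real
polynomials the last condition says `deg p ≤ deg q`; rational functions are not the only
members, so that agents with time delays are covered as well. -/
structure IsProperTransferFunction (f : ℂ → ℂ) : Prop where
  meromorphic : MeromorphicNFOn f closedRHP
  real : ∀ s ∈ closedRHP, f (starRingEnd ℂ s) = starRingEnd ℂ (f s)
  proper : ∃ C R : ℝ, ∀ s ∈ closedRHP, R ≤ ‖s‖ → ‖f s‖ ≤ C

/-- A (meromorphic) transfer function is stable if, off a discrete set of removable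
singularities, it agrees with a function that is analytic and bounded on the closed right
half-plane. For a rational function: it is proper and all its poles have negative real part. -/
def IsStable (f : ℂ → ℂ) : Prop :=
  ∃ h : ℂ → ℂ, AnalyticOnNhd ℂ h closedRHP ∧ (∃ C : ℝ, ∀ s ∈ closedRHP, ‖h s‖ ≤ C) ∧
    f =ᶠ[Filter.codiscreteWithin closedRHP] h

variable {n : ℕ}

/-- The Laplacian matrix of the network with line weights `w i j` (`i ≠ j`). -/
def laplacian (w : Fin n → Fin n → ℝ) : Matrix (Fin n) (Fin n) ℝ :=
  Matrix.of fun i j => if i = j then ∑ l ∈ Finset.univ.erase i, w i l else -w i j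

/-- Symmetric nonnegative line weights whose positive entries form a connected graph. -/
structure IsConnectedNetwork (w : Fin n → Fin n → ℝ) : Prop where
  symm : ∀ i j, w i j = w j i
  nonneg : ∀ i j, 0 ≤ w i j
  connected : (SimpleGraph.fromRel fun i j => 0 < w i j).Connected

/-- The network parameters `γ i = 2 L i i`, the diagonal entries of `Γ`. -/
def gamma (w : Fin n → Fin n → ℝ) (i : Fin n) : ℝ := 2 * laplacian w i i

/-- The diagonal matrix `Γ ^ (1/2)`. -/
def sqrtGamma (w : Fin n → Fin n → ℝ) : Matrix (Fin n) (Fin n) ℂ :=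
  Matrix.diagonal fun i => ((Real.sqrt (gamma w i) : ℝ) : ℂ)

/-- The agent dynamics `G(s) = diag (g 1 (s), …, g n (s))`. -/
def agents (g : Fin n → ℂ → ℂ) (s : ℂ) : Matrix (Fin n) (Fin n) ℂ :=
  Matrix.diagonal fun i => g i s

/-- The normalized agent dynamics `G'(s) = Γ ^ (1/2) G(s) Γ ^ (1/2)`. -/
def normalizedAgents (w : Fin n → Fin n → ℝ) (g : Fin n → ℂ → ℂ) (s : ℂ) :
    Matrix (Fin n) (Fin n) ℂ :=
  sqrtGamma w * agents g s * sqrtGamma w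

/-- `s` is a pole of the transfer matrix `H`. -/
def IsMatrixPole (H : ℂ → Matrix (Fin n) (Fin n) ℂ) (s : ℂ) : Prop :=
  ∃ i j, IsPole (fun z => H z i j) s

/-- The field of values `{vᴴ A v : vᴴ v = 1}`. -/
def fieldOfValues (A : Matrix (Fin n) (Fin n) ℂ) : Set ℂ :=
  {z | ∃ v : Fin n → ℂ, star v ⬝ᵥ v = 1 ∧ z = star v ⬝ᵥ (A *ᵥ v)}

/-- The scaled field of values `α F(A)`. -/
def scaledFieldOfValues (α : ℝ) (A : Matrix (Fin n) (Fin n) ℂ) : Set ℂ :=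
  {z | ∃ y ∈ fieldOfValues A, z = (α : ℂ) * y}

/-- The Nyquist contour of `H`, with outer radius `R` and indentation radius `ε`: the boundary
of the part of the right half-disc of radius `R` that is left when the closed `ε`-discs around
the poles of `H` on the imaginary axis are removed. It consists of the imaginary axis, a
semicircle into the right half-plane, and semicircular indentations into the right half-plane
around the imaginary-axis poles. -/
def nyquistContour (H : ℂ → Matrix (Fin n) (Fin n) ℂ) (R ε : ℝ) : Set ℂ :=
  frontier {s | 0 < s.re ∧ ‖s‖ < R ∧ ∀ p : ℂ, p.re = 0 → IsMatrixPole H p → ε < ‖s - p‖}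

/-- The closed curve `z` on `[0, 1]` has nonzero winding number about `p`: there is a continuous
branch of `log (z t - p)` along the curve that does not return to its initial value. -/
def Winds (z : ℝ → ℂ) (p : ℂ) : Prop :=
  ∃ l : ℝ → ℂ, ContinuousOn l (Set.Icc 0 1) ∧
    (∀ t ∈ Set.Icc (0 : ℝ) 1, Complex.exp (l t) = z t - p) ∧ l 0 ≠ l 1

/-- The sets `S s` encircle `p` as `s` goes around the simple closed contour `D`: for some
parametrization `c` of `D`, some closed curve `z` with `z t ∈ S (c t)` winds around `p`. -/
def Encircles (D : Set ℂ) (S : ℂ → Set ℂ) (p : ℂ) : Prop :=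
  ∃ c z : ℝ → ℂ, ContinuousOn c (Set.Icc 0 1) ∧ c '' Set.Icc 0 1 = D ∧
    Set.InjOn c (Set.Ico 0 1) ∧ c 0 = c 1 ∧
    ContinuousOn z (Set.Icc 0 1) ∧ z 0 = z 1 ∧
    (∀ t ∈ Set.Icc (0 : ℝ) 1, z t ∈ S (c t)) ∧ Winds z p

/-- Along the filter `l`, the sets `α F(H(s))`, `0 < α ≤ 1`, stay at a positive distance
from `-1`. -/
def StaysAwayAlong (H : ℂ → Matrix (Fin n) (Fin n) ℂ) (l : Filter ℂ) : Prop :=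
  ∃ δ : ℝ, 0 < δ ∧ ∀ᶠ s in l, ∀ α ∈ Set.Ioc (0 : ℝ) 1,
    ∀ z ∈ scaledFieldOfValues α (H s), δ ≤ ‖z - (-1)‖

/-- The scaled field of values `α F(H(s))`, `0 < α ≤ 1`, neither contains nor encircles `-1` as
`s` goes around the Nyquist contour, with an infinitely large semicircle and infinitely small
indentations. -/
structure FieldOfValuesCriterion (H : ℂ → Matrix (Fin n) (Fin n) ℂ) : Prop where
  /-- The condition on all contours with large outer radius and small indentations. -/
  contour : ∀ᶠ q : ℝ × ℝ in Filter.atTop ×ˢ nhdsWithin 0 (Set.Ioi 0),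
    ∀ α ∈ Set.Ioc (0 : ℝ) 1,
      (∀ s ∈ nyquistContour H q.1 q.2, (-1 : ℂ) ∉ scaledFieldOfValues α (H s)) ∧
      ¬ Encircles (nyquistContour H q.1 q.2) (fun s => scaledFieldOfValues α (H s)) (-1)
  /-- The infinite semicircle: `-1` is not attained in the limit `s → ∞` either. -/
  infinity : StaysAwayAlong H (Bornology.cobounded ℂ ⊓ Filter.principal closedRHP)
  /-- The infinitesimal indentations at imaginary-axis poles other than the origin: `-1` is not
  attained in the limit either. -/
  indentation : ∀ p : ℂ, p.re = 0 → p ≠ 0 → IsMatrixPole H p →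
    StaysAwayAlong H (nhdsWithin p (closedRHP \ {p}))

/-- The network matrix, over `ℂ`. -/
def network (w : Fin n → Fin n → ℝ) : Matrix (Fin n) (Fin n) ℂ :=
  (laplacian w).map fun x : ℝ => (x : ℂ)

/-- The transfer matrix `(I + G L)⁻¹` from `e` to `δ` in the closed loop
`δ = G (d - L δ) + e`. -/
def outputSensitivity (w : Fin n → Fin n → ℝ) (g : Fin n → ℂ → ℂ) (s : ℂ) :
    Matrix (Fin n) (Fin n) ℂ :=
  (1 + agents g s * network w)⁻¹

/-- The transfer matrix `(I + G L)⁻¹ G` from `d` to `δ` in the closed loop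
`δ = G (d - L δ) + e`. -/
def disturbanceResponse (w : Fin n → Fin n → ℝ) (g : Fin n → ℂ → ℂ) (s : ℂ) :
    Matrix (Fin n) (Fin n) ℂ :=
  outputSensitivity w g s * agents g s

/-- Asymptotic synchronization on the average mode: the closed loop is well defined, and all
interarea modes `vᵀ δ` (`v` an eigenvector of `L` for a nonzero eigenvalue) are stable, as
responses to the external inputs `d` and to perturbations `e` of the outputs. -/
structure AsymptoticallySynchronizes (w : Fin n → Fin n → ℝ) (g : Fin n → ℂ → ℂ) : Prop where
  wellDefined : ∀ᶠ s in Filter.codiscreteWithin closedRHP,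
    (1 + agents g s * network w).det ≠ 0
  modes : ∀ (v : Fin n → ℝ) (μ : ℝ), μ ≠ 0 → laplacian w *ᵥ v = μ • v → ∀ j : Fin n,
    IsStable (fun s => ((fun i => (v i : ℂ)) ᵥ* disturbanceResponse w g s) j) ∧
    IsStable (fun s => ((fun i => (v i : ℂ)) ᵥ* outputSensitivity w g s) j)

end

end ScalableNyquist

/-!
Write `h i = γ i * g i`. The field of values of `G'(s)` is the convex hull of the points `h i (s)`,
so the criterion on the contours says that the functions `1 + ∑ θ i * h i` (`0 ≤ θ i`,
`∑ θ i ≤ 1`) have no zero there.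

*Inside the contours.* For fixed `θ`, the holomorphic function `∑ θ i * h i` has boundary values
outside the half-line `(-∞, -1]`. This half-line does not separate the plane, and the maximum
modulus principle (`ne_ofReal_of_forall_frontier`) shows that the function misses it in the whole
region. Hence `1 + ∑ θ i * h i` has no zero at any point of the closed right half-plane that is not
a pole (`FieldOfValuesCriterion.one_add_sum_ne_zero`).

*The loop at one frequency.* The rows `y = vᵀ (I + G L)⁻¹` and `u = vᵀ (I + G L)⁻¹ G` satisfy
`y + L u = v` and `u i = g i * y i`, and for an interarea mode `v = L m`. Testing `L (u - m) = -y`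
with `u - m` gives `E + ∑ g i |y i|² = yᴴ m` for the energy `E` of `u - m`. Since `L Γ⁻¹ L ≤ L`
(`energy_eq`), the numbers `θ i = |y i|² / (γ i E)` have sum at most one, and the balance reads
`E (1 + ∑ θ i * h i) = yᴴ m`. So the loop is well posed where the criterion holds, and `y` is
bounded where it holds uniformly (`norm_le_of_avoidsBy`); this covers the neighbourhood of infinity.

*Near a point of the closed half-plane.* At a point where some agents, but not all, have a pole, the
loop equations in suitable unknowns converge to a system that is invertible by the same energy
argument: a vanishing output makes the inequality `∑ θ i ≤ 1` strict
(`network_mulVec_eq_zero_of_excess`), so the limit of the criterion suffices, and at the origin,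
where no uniformity is assumed, this limit follows from the reality of the agents
(`FieldOfValuesCriterion.limit_ne_zero`). At a common pole of all agents, the loop equations leave
the mean of `u` undetermined in the limit. It is recovered from `∑ y i = 0`, provided the inverses
`1 / g i` do not cancel (`FieldOfValuesCriterion.exists_tendsto_ratio`): at the origin they are
positive on the positive real axis, and at other poles the criterion forces simple poles with
residues in the open right half-plane (`exists_simple_pole`).

A meromorphic function that is bounded near every point of the closed right half-plane and near
infinity is stable (`isStable_of_bounded`).
-/

namespace ScalableNyquist

section Network

open Finset Complex

variable {n : ℕ} {w : Fin n → Fin n → ℝ}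

/-! ### The energy form of the network -/

/-- The line weights with the irrelevant diagonal entries replaced by zero. -/
def coupling (w : Fin n → Fin n → ℝ) (i j : Fin n) : ℝ := if i = j then 0 else w i j

lemma IsConnectedNetwork.coupling_symm (hw : IsConnectedNetwork w) (i j : Fin n) :
    coupling w i j = coupling w j i := by
  simp only [coupling, eq_comm (a := i), hw.symm i j]

lemma IsConnectedNetwork.coupling_nonneg (hw : IsConnectedNetwork w) (i j : Fin n) :
    0 ≤ coupling w i j := by
  unfold coupling
  split_ifs
  exacts [le_rfl, hw.nonneg i j]

lemma gamma_eq (i : Fin n) : gamma w i = 2 * ∑ j, coupling w i j := by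
  rw [gamma, laplacian, Matrix.of_apply, if_pos rfl, ← sum_erase_add univ _ (mem_univ i)]
  simp only [coupling, if_true, add_zero]
  congr 1
  exact sum_congr rfl fun j hj => (if_neg (ne_of_mem_erase hj).symm).symm

lemma network_mulVec (q : Fin n → ℂ) (i : Fin n) :
    (network w *ᵥ q) i = ∑ j, (coupling w i j : ℂ) * (q i - q j) := by
  simp only [Matrix.mulVec, dotProduct, network, Matrix.map_apply, laplacian, Matrix.of_apply,
    coupling]
  rw [← sum_erase_add univ _ (mem_univ i), ← sum_erase_add (s := univ) (f := fun j =>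
    (((if i = j then 0 else w i j : ℝ)) : ℂ) * (q i - q j)) (mem_univ i)]
  simp only [if_true, sub_self, mul_zero, add_zero, ofReal_sum, sum_mul, ← sum_add_distrib]
  refine sum_congr rfl fun j hj => ?_
  simp only [if_neg (ne_of_mem_erase hj).symm, ofReal_neg]
  ring

lemma network_transpose (hw : IsConnectedNetwork w) : (network w)ᵀ = network w := by
  ext i j
  rcases eq_or_ne i j with rfl | h
  · rfl
  · simp [network, laplacian, h, h.symm, hw.symm i j]

lemma sum_network_mulVec (hw : IsConnectedNetwork w) (q : Fin n → ℂ) :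
    ∑ i, (network w *ᵥ q) i = 0 := by
  have h : ∑ i, (network w *ᵥ q) i = -∑ i, (network w *ᵥ q) i := by
    conv_lhs => simp only [network_mulVec]; rw [sum_comm]
    simp only [network_mulVec, ← sum_neg_distrib]
    refine sum_congr rfl fun i _ => sum_congr rfl fun j _ => ?_
    rw [hw.coupling_symm j i]
    ring
  exact self_eq_neg.mp h

/-- The energy `qᴴ L q = ½ ∑ w i j |q i - q j|²` stored in the lines. -/
noncomputable def energy (w : Fin n → Fin n → ℝ) (q : Fin n → ℂ) : ℝ :=
  (∑ i, ∑ j, coupling w i j * normSq (q i - q j)) / 2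

lemma star_dotProduct_network_mulVec (hw : IsConnectedNetwork w) (q : Fin n → ℂ) :
    star q ⬝ᵥ (network w *ᵥ q) = (energy w q : ℂ) := by
  have h1 : star q ⬝ᵥ (network w *ᵥ q) =
      ∑ i, ∑ j, (coupling w i j : ℂ) * (starRingEnd ℂ (q i) * (q i - q j)) := by
    simp only [dotProduct, network_mulVec, mul_sum]
    refine sum_congr rfl fun i _ => sum_congr rfl fun j _ => ?_
    simp only [Pi.star_apply, RCLike.star_def]
    ring
  have h2 : star q ⬝ᵥ (network w *ᵥ q) =
      ∑ i, ∑ j, (coupling w i j : ℂ) * (starRingEnd ℂ (q j) * (q j - q i)) := by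
    rw [h1, sum_comm]
    refine sum_congr rfl fun i _ => sum_congr rfl fun j _ => ?_
    rw [hw.coupling_symm]
  have h3 : (2 : ℂ) * (star q ⬝ᵥ (network w *ᵥ q)) =
      ∑ i, ∑ j, (coupling w i j : ℂ) * (normSq (q i - q j) : ℂ) := by
    rw [two_mul]
    nth_rewrite 1 [h1]
    rw [h2, ← sum_add_distrib]
    refine sum_congr rfl fun i _ => ?_
    rw [← sum_add_distrib]
    refine sum_congr rfl fun j _ => ?_
    rw [normSq_eq_conj_mul_self, map_sub]
    ring
  rw [energy]
  push_cast
  rw [← h3]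
  ring

/-- The part of the energy that is not accounted for by the injections: a sum of variances. -/
noncomputable def excess (w : Fin n → Fin n → ℝ) (q : Fin n → ℂ) : ℝ :=
  (∑ i, ∑ j, coupling w i j *
    normSq (q i - q j - 2 * (network w *ᵥ q) i / (gamma w i : ℂ))) / 2

lemma IsConnectedNetwork.excess_nonneg (hw : IsConnectedNetwork w) (q : Fin n → ℂ) :
    0 ≤ excess w q :=
  div_nonneg (sum_nonneg fun i _ => sum_nonneg fun j _ =>
    mul_nonneg (hw.coupling_nonneg i j) (normSq_nonneg _)) zero_le_two

/-- For every `i`, the numbers `(L q) i` and `γ i / 2` are the weighted sum of the differences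
`q i - q j` and the total weight; the identity says that the second moment of these differences
is the squared mean plus the variance. It contains the matrix inequality `L Γ⁻¹ L ≤ L`. -/
lemma energy_eq (hγ : ∀ i, 0 < gamma w i) (q : Fin n → ℂ) :
    energy w q = ∑ i, normSq ((network w *ᵥ q) i) / gamma w i + excess w q := by
  have key : ∀ i, ∑ j, coupling w i j * normSq (q i - q j) =
      2 * (normSq ((network w *ᵥ q) i) / gamma w i) + ∑ j, coupling w i j *
        normSq (q i - q j - 2 * (network w *ᵥ q) i / (gamma w i : ℂ)) := by
    intro i
    set y := (network w *ᵥ q) i with hy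
    have hγ0 : (gamma w i : ℂ) ≠ 0 := ofReal_ne_zero.mpr (hγ i).ne'
    have hγC : (gamma w i : ℂ) = 2 * ∑ j, (coupling w i j : ℂ) := by
      rw [gamma_eq]; push_cast; rfl
    have hsum : ∑ j, (coupling w i j : ℂ) = (gamma w i : ℂ) / 2 := by rw [hγC]; ring
    have hyC : ∑ j, (coupling w i j : ℂ) * (q i - q j) = y := (network_mulVec q i).symm
    have hyC' : ∑ j, (coupling w i j : ℂ) * (starRingEnd ℂ (q i - q j)) = starRingEnd ℂ y := by
      rw [← hyC, map_sum]
      exact sum_congr rfl fun j _ => by rw [map_mul, conj_ofReal]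
    set m : ℂ := 2 * y / (gamma w i : ℂ) with hm
    have hmc : starRingEnd ℂ m = 2 * starRingEnd ℂ y / (gamma w i : ℂ) := by
      rw [hm, map_div₀, map_mul, conj_ofReal, map_ofNat]
    have hexp : ∑ j, (coupling w i j : ℂ) * (normSq (q i - q j - m) : ℂ) =
        ∑ j, (coupling w i j : ℂ) * (normSq (q i - q j) : ℂ)
          - m * ∑ j, (coupling w i j : ℂ) * (starRingEnd ℂ (q i - q j))
          - starRingEnd ℂ m * ∑ j, (coupling w i j : ℂ) * (q i - q j)
          + m * starRingEnd ℂ m * ∑ j, (coupling w i j : ℂ) := by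
      simp only [mul_sum, ← sum_sub_distrib, ← sum_add_distrib]
      refine sum_congr rfl fun j _ => ?_
      rw [normSq_eq_conj_mul_self, normSq_eq_conj_mul_self, map_sub (starRingEnd ℂ) _ m]
      ring
    rw [hyC, hyC', hsum, hmc] at hexp
    have hyy : (normSq y : ℂ) = starRingEnd ℂ y * y := normSq_eq_conj_mul_self
    apply ofReal_injective
    push_cast
    rw [hexp, hyy, hm]
    field_simp
    ring
  rw [energy, excess, sum_congr rfl fun i _ => key i, sum_add_distrib, ← mul_sum]
  ring

/-- A property that is handed on along lines of positive weight and holds somewhere holds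
everywhere. -/
lemma IsConnectedNetwork.forall_of_adj (hw : IsConnectedNetwork w) {P : Fin n → Prop}
    (hP : ∀ i j, 0 < coupling w i j → P i → P j) {i : Fin n} (hi : P i) (j : Fin n) : P j := by
  have hr := (SimpleGraph.reachable_iff_reflTransGen _ _).mp (hw.connected.preconnected i j)
  induction hr with
  | refl => exact hi
  | tail _ hab ih =>
    rw [SimpleGraph.fromRel_adj] at hab
    refine hP _ _ ?_ ih
    rw [coupling, if_neg hab.1]
    exact hab.2.elim id fun h => by rwa [hw.symm]

lemma IsConnectedNetwork.eq_of_network_mulVec_eq_zero (hw : IsConnectedNetwork w)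
    {q : Fin n → ℂ} (hq : network w *ᵥ q = 0) (i j : Fin n) : q i = q j := by
  have hE : energy w q = 0 := by
    have := star_dotProduct_network_mulVec hw q
    rw [hq, dotProduct_zero] at this
    exact_mod_cast this.symm
  have hnn : ∀ i j, 0 ≤ coupling w i j * normSq (q i - q j) := fun i j =>
    mul_nonneg (hw.coupling_nonneg i j) (normSq_nonneg _)
  rw [energy, div_eq_zero_iff, or_iff_left two_ne_zero,
    sum_eq_zero_iff_of_nonneg fun i _ => sum_nonneg fun j _ => hnn i j] at hE
  refine hw.forall_of_adj (P := fun j => q i = q j) (fun a b hab ha => ha.trans ?_) rfl j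
  have := (sum_eq_zero_iff_of_nonneg fun j _ => hnn a j).mp (hE a (mem_univ _)) b (mem_univ _)
  exact sub_eq_zero.mp (normSq_eq_zero.mp ((mul_eq_zero.mp this).resolve_left hab.ne'))

/-- If `q` has no excess energy, then `Γ⁻¹ L q` changes sign along every line, so it vanishes as
soon as one of its entries does. -/
lemma IsConnectedNetwork.network_mulVec_eq_zero_of_excess (hw : IsConnectedNetwork w)
    (hγ : ∀ i, 0 < gamma w i) {q : Fin n → ℂ} (hq : excess w q = 0) {i : Fin n}
    (hi : (network w *ᵥ q) i = 0) : network w *ᵥ q = 0 := by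
  have hnn : ∀ i j, 0 ≤ coupling w i j *
      normSq (q i - q j - 2 * (network w *ᵥ q) i / (gamma w i : ℂ)) := fun i j =>
    mul_nonneg (hw.coupling_nonneg i j) (normSq_nonneg _)
  rw [excess, div_eq_zero_iff, or_iff_left two_ne_zero,
    sum_eq_zero_iff_of_nonneg fun i _ => sum_nonneg fun j _ => hnn i j] at hq
  have hedge : ∀ a b, 0 < coupling w a b →
      q a - q b - 2 * (network w *ᵥ q) a / (gamma w a : ℂ) = 0 := fun a b hab =>
    normSq_eq_zero.mp ((mul_eq_zero.mp ((sum_eq_zero_iff_of_nonneg fun j _ => hnn a j).mp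
      (hq a (mem_univ _)) b (mem_univ _))).resolve_left hab.ne')
  ext j
  refine hw.forall_of_adj (P := fun j => (network w *ᵥ q) j = 0) (fun a b hab ha => ?_) hi j
  have h1 := hedge a b hab
  have h2 := hedge b a (by rwa [hw.coupling_symm])
  have hb : (gamma w b : ℂ) ≠ 0 := ofReal_ne_zero.mpr (hγ b).ne'
  simp only [ha, mul_zero, zero_div, sub_zero] at h1
  have h3 : 2 * (network w *ᵥ q) b / (gamma w b : ℂ) = 0 := by linear_combination -h1 - h2
  simpa [hb] using h3

/-- An isolated node is only possible in the network without lines. -/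
lemma IsConnectedNetwork.gamma_pos_or_network_eq_zero (hw : IsConnectedNetwork w) :
    (∀ i, 0 < gamma w i) ∨ network w = 0 := by
  by_contra! h
  obtain ⟨⟨i, hi⟩, hL⟩ := h
  rw [gamma_eq] at hi
  have h0 : ∑ j, coupling w i j = 0 :=
    le_antisymm (by linarith) (sum_nonneg fun j _ => hw.coupling_nonneg i j)
  rw [sum_eq_zero_iff_of_nonneg fun j _ => hw.coupling_nonneg i j] at h0
  have hall : ∀ j, j = i := hw.forall_of_adj (P := fun j => j = i)
    (fun a b hab ha => absurd hab (by rw [ha, h0 b (mem_univ _)]; exact lt_irrefl 0)) rfl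
  apply hL
  ext a b
  have : univ.erase i = (∅ : Finset (Fin n)) := by
    ext j; simp [hall j]
  rw [hall a, hall b, network, Matrix.map_apply, laplacian, Matrix.of_apply, if_pos rfl, this,
    sum_empty, ofReal_zero, Matrix.zero_apply]

/-! ### The loop equations at a fixed frequency -/

/-- With agent gains `a i`, the distance from `-1` to the segments joining `0` to the field of
values of `diag (γ i * a i)`, that is, to the convex hull of `0` and the points `γ i * a i`, is
at least `δ`. -/
def AvoidsBy (w : Fin n → Fin n → ℝ) (a : Fin n → ℂ) (δ : ℝ) : Prop :=
  ∀ θ : Fin n → ℝ, (∀ i, 0 ≤ θ i) → ∑ i, θ i ≤ 1 →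
    δ ≤ ‖1 + ∑ i, (θ i : ℂ) * (gamma w i * a i)‖

lemma energy_add_star_dotProduct (hw : IsConnectedNetwork w) {q y : Fin n → ℂ}
    (h : network w *ᵥ q = -y) : (energy w q : ℂ) + star y ⬝ᵥ q = 0 := by
  have h1 := star_dotProduct_network_mulVec hw q
  have h2 : star y ⬝ᵥ q = starRingEnd ℂ (star q ⬝ᵥ y) := by
    simp only [dotProduct, map_sum, map_mul, Pi.star_apply, RCLike.star_def, conj_conj]
    exact sum_congr rfl fun i _ => mul_comm _ _
  rw [h, dotProduct_neg, neg_eq_iff_eq_neg] at h1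
  rw [h2, h1, map_neg, conj_ofReal, add_neg_cancel]

lemma energy_eq_of_mulVec_eq_neg (hγ : ∀ i, 0 < gamma w i) {q y : Fin n → ℂ}
    (h : network w *ᵥ q = -y) :
    energy w q = ∑ i, normSq (y i) / gamma w i + excess w q := by
  rw [energy_eq hγ q, h]
  simp only [Pi.neg_apply, normSq_neg]

/-- The a priori estimate: the outputs `y` of a loop with inputs in the range of `L` are bounded
in terms of the distance of `-1` from the field of values. -/
lemma norm_le_of_avoidsBy (hw : IsConnectedNetwork w) (hγ : ∀ i, 0 < gamma w i)
    {a y m : Fin n → ℂ} {δ : ℝ} (hδ : 0 < δ) (ha : AvoidsBy w a δ)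
    (h : y + network w *ᵥ (fun i => a i * y i) = network w *ᵥ m) (i : Fin n) :
    ‖y i‖ ≤ √(gamma w i) * ((∑ j, √(gamma w j) * ‖m j‖) / δ) := by
  set q : Fin n → ℂ := (fun i => a i * y i) - m with hq
  have hLq : network w *ᵥ q = -y := by
    rw [hq, Matrix.mulVec_sub, ← h]; abel
  set E := energy w q with hE
  have hE1 : E = ∑ i, normSq (y i) / gamma w i + excess w q :=
    energy_eq_of_mulVec_eq_neg hγ hLq
  have hterm : ∀ i, 0 ≤ normSq (y i) / gamma w i := fun i =>
    div_nonneg (normSq_nonneg _) (hγ i).le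
  have hT : ∑ i, normSq (y i) / gamma w i ≤ E := by
    rw [hE1]; exact le_add_of_nonneg_right (hw.excess_nonneg q)
  have hE0 : 0 ≤ E := (sum_nonneg fun i _ => hterm i).trans hT
  have hy : ∀ i, ‖y i‖ ≤ √(gamma w i) * √E := by
    intro i
    rw [← Real.sqrt_mul (hγ i).le]
    apply Real.le_sqrt_of_sq_le
    rw [← normSq_eq_norm_sq, mul_comm, ← div_le_iff₀ (hγ i)]
    exact (single_le_sum (fun j _ => hterm j) (mem_univ i)).trans hT
  set C := ∑ j, √(gamma w j) * ‖m j‖ with hC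
  have hC0 : 0 ≤ C := sum_nonneg fun j _ => mul_nonneg (Real.sqrt_nonneg _) (norm_nonneg _)
  have hmain : √E ≤ C / δ := by
    rcases hE0.eq_or_lt with h0 | hpos
    · rw [← h0, Real.sqrt_zero]; exact div_nonneg hC0 hδ.le
    have hEC : (E : ℂ) ≠ 0 := ofReal_ne_zero.mpr hpos.ne'
    -- dividing the energy balance by `E` exhibits a point of the convex hull
    have hbal : (E : ℂ) * (1 + ∑ i, ((normSq (y i) / gamma w i / E : ℝ) : ℂ) *
        (gamma w i * a i)) = star y ⬝ᵥ m := by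
      have h1 := energy_add_star_dotProduct hw hLq
      rw [hq, dotProduct_sub, ← hq, ← hE] at h1
      have h2 : (E : ℂ) * ∑ i, ((normSq (y i) / gamma w i / E : ℝ) : ℂ) * (gamma w i * a i) =
          star y ⬝ᵥ (fun i => a i * y i) := by
        rw [mul_sum]
        refine sum_congr rfl fun i _ => ?_
        have hγ0 : (gamma w i : ℂ) ≠ 0 := ofReal_ne_zero.mpr (hγ i).ne'
        push_cast
        rw [normSq_eq_conj_mul_self, Pi.star_apply, RCLike.star_def]
        field_simp
      rw [mul_add, mul_one, h2]
      linear_combination h1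
    have hδE : E * δ ≤ √E * C := by
      calc E * δ ≤ E * ‖1 + ∑ i, ((normSq (y i) / gamma w i / E : ℝ) : ℂ) *
              (gamma w i * a i)‖ := by
            refine mul_le_mul_of_nonneg_left (ha _ (fun i => div_nonneg (hterm i) hE0) ?_) hE0
            rw [← sum_div]
            exact div_le_one_of_le₀ hT hE0
        _ = ‖star y ⬝ᵥ m‖ := by
            rw [← hbal, norm_mul, norm_real, Real.norm_of_nonneg hE0]
        _ ≤ ∑ i, √(gamma w i) * √E * ‖m i‖ := by
            refine (norm_sum_le _ _).trans (sum_le_sum fun i _ => ?_)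
            rw [norm_mul, Pi.star_apply, norm_star]
            exact mul_le_mul_of_nonneg_right (hy i) (norm_nonneg _)
        _ = √E * C := by
            rw [hC, mul_sum]
            exact sum_congr rfl fun i _ => by ring
    have hs : 0 < √E := Real.sqrt_pos.mpr hpos
    rw [le_div_iff₀ hδ]
    refine le_of_mul_le_mul_left ?_ hs
    rwa [← mul_assoc, Real.mul_self_sqrt hE0]
  exact (hy i).trans (mul_le_mul_of_nonneg_left hmain (Real.sqrt_nonneg _))

/-- A nonzero solution of the homogeneous loop equations puts `-1` into the convex hull of `0`
and the points `γ i * b i`. Nodes with `y i = 0` get no weight, and if there are any, then the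
weights sum to less than one. -/
lemma exists_weights_of_ne_zero (hw : IsConnectedNetwork w) (hγ : ∀ i, 0 < gamma w i)
    {b y f : Fin n → ℂ} (h : y + network w *ᵥ f = 0) (hf : ∀ i, y i ≠ 0 → f i = b i * y i)
    (hy : y ≠ 0) : ∃ θ : Fin n → ℝ, (∀ i, 0 ≤ θ i) ∧ (∀ i, y i = 0 → θ i = 0) ∧ ∑ i, θ i ≤ 1 ∧
      ((∃ i, y i = 0) → ∑ i, θ i < 1) ∧ 1 + ∑ i, (θ i : ℂ) * (gamma w i * b i) = 0 := by
  have hLf : network w *ᵥ f = -y := (neg_eq_of_add_eq_zero_right h).symm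
  set E := energy w f with hE
  have hE1 : E = ∑ i, normSq (y i) / gamma w i + excess w f :=
    energy_eq_of_mulVec_eq_neg hγ hLf
  have hterm : ∀ i, 0 ≤ normSq (y i) / gamma w i := fun i =>
    div_nonneg (normSq_nonneg _) (hγ i).le
  obtain ⟨k, hk⟩ := Function.ne_iff.mp hy
  have hpos : 0 < E := by
    rw [hE1]
    exact add_pos_of_pos_of_nonneg (sum_pos' (fun i _ => hterm i)
      ⟨k, mem_univ k, div_pos (normSq_pos.mpr hk) (hγ k)⟩) (hw.excess_nonneg f)
  have hEC : (E : ℂ) ≠ 0 := ofReal_ne_zero.mpr hpos.ne'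
  refine ⟨fun i => normSq (y i) / gamma w i / E, fun i => div_nonneg (hterm i) hpos.le,
    fun i hi => by simp [hi], ?_, ?_, ?_⟩
  · rw [← sum_div, div_le_one hpos, hE1]
    exact le_add_of_nonneg_right (hw.excess_nonneg f)
  · rintro ⟨i, hi⟩
    rw [← sum_div, div_lt_one hpos, hE1]
    refine lt_add_of_pos_right _ ((hw.excess_nonneg f).lt_of_ne fun h0 => hy ?_)
    have := hw.network_mulVec_eq_zero_of_excess hγ h0.symm (i := i) (by rw [hLf]; simp [hi])
    rwa [hLf, neg_eq_zero] at this
  · have h1 := energy_add_star_dotProduct hw hLf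
    have h2 : (E : ℂ) * ∑ i, ((normSq (y i) / gamma w i / E : ℝ) : ℂ) * (gamma w i * b i) =
        star y ⬝ᵥ f := by
      rw [mul_sum]
      refine sum_congr rfl fun i _ => ?_
      rcases eq_or_ne (y i) 0 with hi | hi
      · simp [hi]
      have hγ0 : (gamma w i : ℂ) ≠ 0 := ofReal_ne_zero.mpr (hγ i).ne'
      push_cast
      rw [normSq_eq_conj_mul_self, Pi.star_apply, RCLike.star_def, hf i hi]
      field_simp
    rw [← mul_right_inj' hEC, mul_add, mul_one, h2, mul_zero]
    exact h1

/-- The closed loop is well posed when `-1` is not in the scaled fields of values. -/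
lemma det_one_add_network_mul_diagonal_ne_zero (hw : IsConnectedNetwork w)
    (hγ : ∀ i, 0 < gamma w i) {a : Fin n → ℂ}
    (ha : ∀ θ : Fin n → ℝ, (∀ i, 0 ≤ θ i) → ∑ i, θ i ≤ 1 →
      1 + ∑ i, (θ i : ℂ) * (gamma w i * a i) ≠ 0) :
    (1 + network w * Matrix.diagonal a).det ≠ 0 := by
  intro hdet
  obtain ⟨y, hy, h⟩ := Matrix.exists_mulVec_eq_zero_iff.mpr hdet
  rw [Matrix.add_mulVec, Matrix.one_mulVec, ← Matrix.mulVec_mulVec] at h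
  obtain ⟨θ, h0, -, h1, -, h2⟩ := exists_weights_of_ne_zero (b := a) hw hγ h
    (fun i _ => Matrix.mulVec_diagonal a y i) hy
  exact ha θ h0 h1 h2

/-- The loop equations at a frequency where the gains of the nodes in `P`, but not of all nodes,
are infinite. The unknown is the input of an agent in `P` and the output of any other agent. -/
lemma det_limit_ne_zero (hw : IsConnectedNetwork w) (hγ : ∀ i, 0 < gamma w i)
    {P : Fin n → Prop} [DecidablePred P] (hP : ∃ i, P i) (hP' : ∃ i, ¬ P i) {b : Fin n → ℂ}
    (hb : ∀ θ : Fin n → ℝ, (∀ i, 0 ≤ θ i) → (∀ i, P i → θ i = 0) → ∑ i, θ i < 1 →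
      1 + ∑ i, (θ i : ℂ) * (gamma w i * b i) ≠ 0) :
    (Matrix.diagonal (fun i => if P i then (0 : ℂ) else 1) +
      network w * Matrix.diagonal (fun i => if P i then (1 : ℂ) else b i)).det ≠ 0 := by
  intro hdet
  obtain ⟨x, hx, h⟩ := Matrix.exists_mulVec_eq_zero_iff.mpr hdet
  rw [Matrix.add_mulVec, ← Matrix.mulVec_mulVec] at h
  set y := Matrix.diagonal (fun i => if P i then (0 : ℂ) else 1) *ᵥ x with hy
  set f := Matrix.diagonal (fun i => if P i then (1 : ℂ) else b i) *ᵥ x with hf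
  have hyi : ∀ i, y i = (if P i then (0 : ℂ) else 1) * x i := fun i =>
    Matrix.mulVec_diagonal _ _ _
  have hfi : ∀ i, f i = (if P i then (1 : ℂ) else b i) * x i := fun i =>
    Matrix.mulVec_diagonal _ _ _
  obtain ⟨k, hk⟩ := hP
  have hy0 : y = 0 := by
    by_contra hne
    obtain ⟨θ, h0, hθ, -, h1, h2⟩ := exists_weights_of_ne_zero (b := b) hw hγ h
      (fun i hi => by
        have : ¬ P i := fun hPi => hi (by rw [hyi, if_pos hPi, zero_mul])
        rw [hfi, hyi, if_neg this, if_neg this, one_mul]) hne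
    exact hb θ h0 (fun i hi => hθ i (by rw [hyi, if_pos hi, zero_mul]))
      (h1 ⟨k, by rw [hyi, if_pos hk, zero_mul]⟩) h2
  have hxN : ∀ i, ¬ P i → x i = 0 := fun i hi => by
    have := hyi i
    rwa [hy0, if_neg hi, one_mul, Pi.zero_apply, eq_comm] at this
  rw [hy0, zero_add] at h
  obtain ⟨l, hl⟩ := hP'
  apply hx
  ext i
  by_cases hi : P i
  · have := hw.eq_of_network_mulVec_eq_zero h i l
    rwa [hfi, hfi, if_pos hi, hxN l hl, mul_zero, one_mul] at this
  · exact hxN i hi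

/-- The loop equations, with the agent inputs as unknowns, at a frequency where all gains are
infinite: there remains a weighted average of the equations that fixes the mean value of the
inputs. -/
lemma det_network_add_replicate_ne_zero (hw : IsConnectedNetwork w) {β : Fin n → ℂ}
    (hβ : ∑ i, β i = 1) : (network w + Matrix.of fun _ i => β i).det ≠ 0 := by
  intro hdet
  obtain ⟨x, hx, h⟩ := Matrix.exists_mulVec_eq_zero_iff.mpr hdet
  rw [Matrix.add_mulVec] at h
  have hR : (Matrix.of fun (_ : Fin n) i => β i) *ᵥ x = fun _ => β ⬝ᵥ x := rfl
  rw [hR] at h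
  obtain ⟨k, hk⟩ := Function.ne_iff.mp hx
  have hn : (n : ℂ) ≠ 0 := by
    rintro h0
    rw [Nat.cast_eq_zero] at h0
    subst h0
    exact k.elim0
  have hβx : β ⬝ᵥ x = 0 := by
    have := congrArg (fun z => ∑ i, z i) h
    simp only [Pi.add_apply, sum_add_distrib, sum_network_mulVec hw, zero_add, sum_const,
      card_univ, Fintype.card_fin, nsmul_eq_mul, Pi.zero_apply, mul_zero] at this
    exact (mul_eq_zero.mp this).resolve_left hn
  have hLx : network w *ᵥ x = 0 := by
    rw [← h, hβx]
    ext i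
    simp
  have hconst := hw.eq_of_network_mulVec_eq_zero hLx
  apply hk
  have : β ⬝ᵥ x = x k := by
    rw [dotProduct, sum_congr rfl fun i _ => by rw [hconst i k], ← sum_mul, hβ, one_mul]
  rw [← this, hβx, Pi.zero_apply]

end Network

open Complex Filter Topology Set

/-! ### Values on the closed negative half-line below `-1` -/

/-- A holomorphic function on a bounded set whose boundary values miss the half-line `(-∞, -1]`
misses it everywhere. If `x₀` were the least value in the half-line, then `1 / (f - x)`, for real
`x < x₀` close to `x₀`, would violate the maximum modulus principle. -/
lemma ne_ofReal_of_forall_frontier {U : Set ℂ} (hU : Bornology.IsBounded U) {f : ℂ → ℂ}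
    (hf : DiffContOnCl ℂ f U) (hfr : ∀ z ∈ frontier U, ∀ x : ℝ, x ≤ -1 → f z ≠ x) {z : ℂ}
    (hz : z ∈ closure U) {x : ℝ} (hx : x ≤ -1) : f z ≠ x := by
  intro hzx
  set N : Set ℂ := ofReal '' Iic (-1) with hN
  have hNc : IsClosed N := Complex.isometry_ofReal.isClosedEmbedding.isClosedMap _ isClosed_Iic
  have hK : IsCompact (f '' frontier U) :=
    ((hU.isCompact_closure).of_isClosed_subset isClosed_frontier
      frontier_subset_closure).image_of_continuousOn (hf.2.mono frontier_subset_closure)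
  obtain ⟨δ, hδ, hdis⟩ := Disjoint.exists_thickenings (s := f '' frontier U) (t := N)
    (disjoint_left.mpr (by
      rintro _ ⟨u, hu, rfl⟩ ⟨t, ht, htu⟩
      exact hfr u hu t ht htu.symm)) hK hNc
  have hfar : ∀ u ∈ frontier U, ∀ t : ℝ, t ≤ -1 → δ ≤ ‖f u - t‖ := by
    intro u hu t ht
    by_contra! hlt
    refine disjoint_left.mp hdis (Metric.mem_thickening_iff.mpr
      ⟨f u, mem_image_of_mem f hu, ?_⟩) (Metric.self_subset_thickening hδ N
        (mem_image_of_mem ofReal (mem_Iic.mpr ht)))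
    rwa [dist_comm, dist_eq]
  -- the real parts of the values in the half-line have a least element
  have hV : IsCompact (f '' closure U ∩ N) :=
    (hU.isCompact_closure.image_of_continuousOn hf.2).inter_right hNc
  obtain ⟨_, ⟨⟨u, hu, rfl⟩, ⟨x₀, hx₀, hux₀⟩⟩, hmin⟩ := hV.exists_isMinOn
    ⟨f z, mem_image_of_mem f hz, x, hx, hzx.symm⟩ continuous_re.continuousOn
  have hmiss : ∀ v ∈ closure U, f v - ((x₀ - δ / 2 : ℝ) : ℂ) ≠ 0 := by
    intro v hv h0
    rw [sub_eq_zero] at h0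
    have hle : x₀ - δ / 2 ≤ -1 := by
      have := mem_Iic.mp hx₀
      linarith
    have := hmin ⟨mem_image_of_mem f hv, x₀ - δ / 2, hle, h0.symm⟩
    simp only [mem_ofPred_eq, ← hux₀, h0, ofReal_re] at this
    linarith
  have hbd := norm_le_of_forall_mem_frontier_norm_le hU
    (f := fun v => (f v - ((x₀ - δ / 2 : ℝ) : ℂ))⁻¹)
    ((hf.sub_const _).inv hmiss) (C := δ⁻¹) (fun v hv => by
      rw [norm_inv]
      refine inv_anti₀ hδ (hfar v hv _ ?_)
      have := mem_Iic.mp hx₀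
      linarith) hu
  rw [← hux₀, norm_inv, ← ofReal_sub, norm_real, sub_sub_cancel,
    Real.norm_of_nonneg (by positivity)] at hbd
  have := (inv_le_inv₀ (by positivity) hδ).mp hbd
  linarith

/-! ### Stability from local bounds -/

lemma tendsto_add_mul_nhdsWithin {p ζ : ℂ} (hp : p ∈ closedRHP) (hζ : 0 ≤ ζ.re) (hζ0 : ζ ≠ 0) :
    Tendsto (fun ρ : ℝ => p + ρ * ζ) (𝓝[>] 0) (𝓝[closedRHP \ {p}] p) := by
  refine tendsto_nhdsWithin_iff.mpr ⟨?_, ?_⟩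
  · have : Tendsto (fun ρ : ℝ => p + ρ * ζ) (𝓝 0) (𝓝 (p + (0 : ℝ) * ζ)) :=
      (continuous_const.add (continuous_ofReal.mul continuous_const)).tendsto 0
    rw [ofReal_zero, zero_mul, add_zero] at this
    exact this.mono_left nhdsWithin_le_nhds
  · filter_upwards [self_mem_nhdsWithin] with ρ hρ
    have hρ : 0 < ρ := hρ
    have hp : 0 ≤ p.re := hp
    refine ⟨?_, by simpa [hζ0] using hρ.ne'⟩
    change 0 ≤ (p + ρ * ζ).re
    rw [add_re, re_ofReal_mul]
    positivity

lemma neBot_nhdsWithin_closedRHP {p : ℂ} (hp : p ∈ closedRHP) :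
    (𝓝[closedRHP \ {p}] p).NeBot :=
  (tendsto_add_mul_nhdsWithin hp (by simp) one_ne_zero).neBot

lemma nhdsWithin_closedRHP_le_nhdsNE (p : ℂ) : 𝓝[closedRHP \ {p}] p ≤ 𝓝[≠] p :=
  nhdsWithin_mono p fun _ hs => hs.2

lemma meromorphicOrderAt_nonneg_of_bounded {f : ℂ → ℂ} {p : ℂ} {l : Filter ℂ} [l.NeBot]
    (hl : l ≤ 𝓝[≠] p) {C : ℝ} (hC : ∀ᶠ s in l, ‖f s‖ ≤ C) : 0 ≤ meromorphicOrderAt f p := by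
  by_contra! h
  have := (tendsto_norm_atTop_iff_cobounded.mpr
    (tendsto_cobounded_of_meromorphicOrderAt_neg h)).mono_left hl
  obtain ⟨s, hs, hs'⟩ := (hC.and (this.eventually_gt_atTop C)).exists
  exact hs.not_gt hs'

/-- A meromorphic function is stable if it is bounded near infinity and near every point of the
closed right half-plane, as seen from within the half-plane. -/
lemma isStable_of_bounded {f : ℂ → ℂ} (hf : MeromorphicOn f closedRHP)
    (hloc : ∀ p ∈ closedRHP, ∃ C : ℝ, ∀ᶠ s in 𝓝[closedRHP \ {p}] p, ‖f s‖ ≤ C)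
    (hinf : ∃ C : ℝ, ∀ᶠ s in Bornology.cobounded ℂ ⊓ 𝓟 closedRHP, ‖f s‖ ≤ C) : IsStable f := by
  have hclosed : IsClosed closedRHP := isClosed_le continuous_const continuous_re
  set h := toMeromorphicNFOn f closedRHP with hh
  have han : AnalyticOnNhd ℂ h closedRHP := by
    intro p hp
    have hNF : MeromorphicNFAt h p := meromorphicNFOn_toMeromorphicNFOn f closedRHP hp
    refine hNF.meromorphicOrderAt_nonneg_iff_analyticAt.mp ?_
    rw [hh, meromorphicOrderAt_toMeromorphicNFOn hf hp]
    obtain ⟨C, hC⟩ := hloc p hp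
    have := neBot_nhdsWithin_closedRHP hp
    exact meromorphicOrderAt_nonneg_of_bounded (nhdsWithin_closedRHP_le_nhdsNE p) hC
  have hcont : ContinuousOn h closedRHP := han.continuousOn
  refine ⟨h, han, ?_, toMeromorphicNFOn_eqOn_codiscrete hf⟩
  obtain ⟨C, hC⟩ := hinf
  rw [eventually_inf_principal, ← comap_norm_atTop, eventually_comap, eventually_atTop] at hC
  obtain ⟨R, hR⟩ := hC
  obtain ⟨C', hC'⟩ := ((isCompact_closedBall (0 : ℂ) R).inter_left
    hclosed).exists_bound_of_continuousOn (hcont.mono inter_subset_left)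
  refine ⟨max C C', fun s hs => ?_⟩
  rcases le_or_gt ‖s‖ R with hsR | hsR
  · exact (hC' s ⟨hs, by simpa using hsR⟩).trans (le_max_right _ _)
  refine le_trans ?_ (le_max_left _ _)
  have := neBot_nhdsWithin_closedRHP hs
  have hlim : Tendsto (fun z => ‖h z‖) (𝓝[closedRHP \ {s}] s) (𝓝 ‖h s‖) :=
    ((han s hs).continuousAt.norm).mono_left nhdsWithin_le_nhds
  refine le_of_tendsto hlim ?_
  have h1 : ∀ᶠ z in 𝓝[closedRHP \ {s}] s, h z = f z :=
    (hf.toMeromorphicNFOn_eq_self_on_nhdsNE hs).filter_mono (nhdsWithin_closedRHP_le_nhdsNE s)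
  have h2 : ∀ᶠ z in 𝓝[closedRHP \ {s}] s, R < ‖z‖ :=
    nhdsWithin_le_nhds (continuous_norm.continuousAt.eventually_const_lt hsR)
  filter_upwards [h1, h2, self_mem_nhdsWithin] with z hz1 hz2 hz3
  rw [hz1]
  exact hR ‖z‖ hz2.le z rfl hz3.1

/-- Solutions of linear systems stay bounded when the matrix tends to an invertible one. -/
lemma exists_bound_of_tendsto {n : ℕ} {l : Filter ℂ} {K : ℂ → Matrix (Fin n) (Fin n) ℂ}
    {K₀ : Matrix (Fin n) (Fin n) ℂ} (hK : Tendsto K l (𝓝 K₀)) (hK₀ : K₀.det ≠ 0)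
    {r : ℂ → Fin n → ℂ} {v : Fin n → ℂ} (hr : ∀ᶠ s in l, K s *ᵥ r s = v) (i : Fin n) :
    ∃ C : ℝ, ∀ᶠ s in l, ‖r s i‖ ≤ C := by
  have hdet : Tendsto (fun s => (K s).det) l (𝓝 K₀.det) :=
    ((continuous_id.matrix_det).tendsto K₀).comp hK
  have hadj : Tendsto (fun s => (K s).adjugate *ᵥ v) l (𝓝 (K₀.adjugate *ᵥ v)) :=
    (((continuous_id.matrix_adjugate).matrix_mulVec continuous_const).tendsto K₀).comp hK
  have hlim := (((tendsto_pi_nhds.mp hadj) i).div hdet hK₀).norm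
  refine ⟨‖(K₀.adjugate *ᵥ v) i / K₀.det‖ + 1, ?_⟩
  · filter_upwards [hr, hdet.eventually_ne hK₀, hlim.eventually_lt_const (lt_add_one _)]
      with s hs hs0 hlt
    have hsol : (K s).det * r s i = ((K s).adjugate *ᵥ v) i := by
      rw [← hs, Matrix.mulVec_mulVec, Matrix.adjugate_mul, Matrix.smul_mulVec, Matrix.one_mulVec]
      rfl
    have : r s i = ((K s).adjugate *ᵥ v) i / (K s).det := by
      rw [← hsol, mul_div_cancel_left₀ _ hs0]
    rw [this]
    exact hlt.le

/-! ### The common poles of all agents -/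

/-- Meromorphic functions that are positive on a real half-line ending at `p` do not cancel: near
`p`, each is a convergent multiple of their sum, since on the half-line the ratio is at most one
and a meromorphic function cannot have a pole where it is bounded along a sequence. -/
lemma exists_tendsto_ratio_of_pos {ι : Type*} [Fintype ι] [Nonempty ι] {a : ι → ℂ → ℂ} {p : ℂ}
    (hp : p ∈ closedRHP) (ha : ∀ i, MeromorphicAt (a i) p)
    (hpos : ∀ᶠ x : ℝ in 𝓝[>] 0, ∀ i, ∃ t : ℝ, 0 < t ∧ a i (p + x * 1) = t) :
    ∃ β : ι → ℂ, ∑ i, β i = 1 ∧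
      ∀ i, Tendsto (fun s => a i s / ∑ j, a j s) (𝓝[≠] p) (𝓝 (β i)) := by
  have hray : Tendsto (fun x : ℝ => p + x * 1) (𝓝[>] 0) (𝓝[≠] p) :=
    (tendsto_add_mul_nhdsWithin hp (by simp) one_ne_zero).mono_right
      (nhdsWithin_closedRHP_le_nhdsNE p)
  have hne : (map (fun x : ℝ => p + x * 1) (𝓝[>] 0)).NeBot := inferInstance
  have hlim : ∀ i, ∃ c, Tendsto (fun s => a i s / ∑ j, a j s) (𝓝[≠] p) (𝓝 c) := by
    intro i
    have hm : MeromorphicAt (fun s => a i s / ∑ j, a j s) p :=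
      (ha i).div (MeromorphicAt.fun_sum fun j _ => ha j)
    refine tendsto_nhds_of_meromorphicOrderAt_nonneg hm
      (meromorphicOrderAt_nonneg_of_bounded (C := 1) hray ?_)
    rw [eventually_map]
    filter_upwards [hpos] with x hx
    choose t ht hat using hx
    have hsum : ∑ j, a j (p + x * 1) = ((∑ j, t j : ℝ) : ℂ) := by
      push_cast; exact Finset.sum_congr rfl fun j _ => hat j
    rw [hsum, hat, ← ofReal_div, norm_real, Real.norm_of_nonneg
      (div_nonneg (ht i).le (Finset.sum_nonneg fun j _ => (ht j).le))]
    exact div_le_one_of_le₀ (Finset.single_le_sum (fun j _ => (ht j).le) (Finset.mem_univ i))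
      (Finset.sum_nonneg fun j _ => (ht j).le)
  choose β hβ using hlim
  refine ⟨β, ?_, hβ⟩
  have h1 := (tendsto_finsetSum Finset.univ fun i _ => hβ i).comp hray
  refine tendsto_nhds_unique h1 (tendsto_const_nhds.congr' ?_)
  filter_upwards [hpos] with x hx
  choose t ht hat using hx
  have hsum : ∑ j, a j (p + x * 1) = ((∑ j, t j : ℝ) : ℂ) := by
    push_cast; exact Finset.sum_congr rfl fun j _ => hat j
  have h0 : ∑ j, a j (p + x * 1) ≠ 0 := by
    rw [hsum, ofReal_ne_zero]
    exact (Finset.sum_pos (fun j _ => ht j) Finset.univ_nonempty).ne'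
  simp only [Function.comp_apply, ← Finset.sum_div]
  exact (div_self h0).symm

/-- If, near a pole `p`, the ray through the values of `f` on the closed half-plane to the right
of `p` stays away from `-1`, then the pole is simple and its residue has positive real part.
Indeed `f (p + ρ ζ) ≈ e ζ⁻ᵏ ρ⁻ᵏ`, and unless `k = 1` and `0 < Re e` there is a direction `ζ` with
`0 ≤ Re ζ` and `ζᵏ = -e`. -/
lemma exists_simple_pole {f : ℂ → ℂ} {p : ℂ} (hp : p ∈ closedRHP) (hf : meromorphicOrderAt f p < 0)
    {κ δ : ℝ} (hκ : 0 < κ) (hδ : 0 < δ)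
    (hstay : ∀ᶠ s in 𝓝[closedRHP \ {p}] p, ∀ α ∈ Ioc (0 : ℝ) κ, δ ≤ ‖1 + α * f s‖) :
    ∃ e : ℂ → ℂ, ContinuousAt e p ∧ 0 < (e p).re ∧ ∀ᶠ s in 𝓝[≠] p, f s = (s - p)⁻¹ * e s := by
  have hm : MeromorphicAt f p := meromorphicAt_of_meromorphicOrderAt_ne_zero hf.ne
  obtain ⟨m, hm'⟩ := WithTop.ne_top_iff_exists.mp hf.ne_top
  rw [← hm'] at hf
  have hm0 : m < 0 := by exact_mod_cast hf
  obtain ⟨k, rfl⟩ : ∃ k : ℕ, m = -(k : ℤ) := ⟨m.natAbs, by omega⟩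
  have hk : k ≠ 0 := by rintro rfl; simp at hm0
  obtain ⟨e, he, hep, hfe⟩ := (meromorphicOrderAt_eq_int_iff hm).mp hm'.symm
  have hdir : ∀ ζ : ℂ, 0 ≤ ζ.re → ζ ^ k ≠ -e p := by
    intro ζ hζ hζe
    have hζ0 : ζ ≠ 0 := by
      rintro rfl
      rw [zero_pow hk, eq_comm, neg_eq_zero] at hζe
      exact hep hζe
    have hray := tendsto_add_mul_nhdsWithin hp hζ hζ0
    have hrayNE := hray.mono_right (nhdsWithin_closedRHP_le_nhdsNE p)
    have hpow : ∀ᶠ ρ : ℝ in 𝓝[>] 0, ρ ^ k ≤ κ := by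
      have : Tendsto (fun ρ : ℝ => ρ ^ k) (𝓝[>] 0) (𝓝 (0 ^ k)) :=
        ((continuous_pow k).tendsto 0).mono_left nhdsWithin_le_nhds
      rw [zero_pow hk] at this
      exact this.eventually_le_const hκ
    have hlim : Tendsto (fun ρ : ℝ => ‖1 + (ζ ^ k)⁻¹ * e (p + ρ * ζ)‖) (𝓝[>] 0)
        (𝓝 ‖1 + (ζ ^ k)⁻¹ * e p‖) :=
      (tendsto_const_nhds.add (tendsto_const_nhds.mul
        (he.continuousAt.tendsto.comp (hray.mono_right nhdsWithin_le_nhds)))).norm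
    have hge : δ ≤ ‖1 + (ζ ^ k)⁻¹ * e p‖ := by
      refine ge_of_tendsto hlim ?_
      filter_upwards [hray.eventually hstay, hrayNE.eventually hfe, hpow, self_mem_nhdsWithin]
        with ρ h1 h2 h3 h4
      have h4 : 0 < ρ := h4
      have hρ : (ρ : ℂ) ≠ 0 := ofReal_ne_zero.mpr h4.ne'
      have := h1 (ρ ^ k) ⟨pow_pos h4 k, h3⟩
      have hval : ((ρ ^ k : ℝ) : ℂ) * f (p + ρ * ζ) = (ζ ^ k)⁻¹ * e (p + ρ * ζ) := by
        rw [h2, add_sub_cancel_left, smul_eq_mul, zpow_neg, zpow_natCast, mul_pow]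
        push_cast
        field_simp
      rwa [hval] at this
    have h0 : 1 + (ζ ^ k)⁻¹ * e p = 0 := by
      rw [hζe, inv_neg, neg_mul, inv_mul_cancel₀ hep, add_neg_cancel]
    rw [h0, norm_zero] at hge
    exact hge.not_gt hδ
  have hk1 : k = 1 := by
    by_contra hne
    have hk2 : (2 : ℝ) ≤ k := by exact_mod_cast (by omega : 2 ≤ k)
    have hkC : (k : ℂ) ≠ 0 := Nat.cast_ne_zero.mpr hk
    refine hdir (exp (log (-e p) / k)) ?_ ?_
    · rw [exp_re]
      refine mul_nonneg (Real.exp_pos _).le (Real.cos_nonneg_of_mem_Icc ?_)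
      rw [div_natCast_im, log_im]
      have h1 := neg_pi_lt_arg (-e p)
      have h2 := arg_le_pi (-e p)
      have hpi := Real.pi_pos
      constructor
      · rw [le_div_iff₀ (by linarith)]
        nlinarith
      · rw [div_le_iff₀ (by linarith)]
        nlinarith
    · rw [← exp_nat_mul, mul_div_cancel₀ _ hkC, exp_log (neg_ne_zero.mpr hep)]
  subst hk1
  refine ⟨e, he.continuousAt, ?_, ?_⟩
  · by_contra! hre
    exact hdir (-e p) (by simpa using hre) (pow_one _)
  · filter_upwards [hfe] with s hs
    rw [hs, smul_eq_mul, Nat.cast_one, zpow_neg_one]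

section Criterion

variable {n : ℕ} {w : Fin n → Fin n → ℝ} {g : Fin n → ℂ → ℂ}

/-! ### The field of values of the normalized agents -/

lemma normalizedAgents_eq_diagonal (hγ : ∀ i, 0 < gamma w i) (s : ℂ) :
    normalizedAgents w g s = Matrix.diagonal fun i => (gamma w i : ℂ) * g i s := by
  rw [normalizedAgents, sqrtGamma, agents, Matrix.diagonal_mul_diagonal,
    Matrix.diagonal_mul_diagonal]
  congr 1
  ext i
  have h : ((√(gamma w i) : ℝ) : ℂ) * ((√(gamma w i) : ℝ) : ℂ) = gamma w i := by
    rw [← ofReal_mul, Real.mul_self_sqrt (hγ i).le]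
  linear_combination g i s * h

lemma isMatrixPole_normalizedAgents_iff (hγ : ∀ i, 0 < gamma w i) {p : ℂ} :
    IsMatrixPole (normalizedAgents w g) p ↔ ∃ i, meromorphicOrderAt (g i) p < 0 := by
  have hdiag : ∀ i, meromorphicOrderAt (fun z => normalizedAgents w g z i i) p =
      meromorphicOrderAt (g i) p := by
    intro i
    have : (fun z => normalizedAgents w g z i i) = (fun _ => (gamma w i : ℂ)) * g i := by
      ext z
      rw [normalizedAgents_eq_diagonal hγ, Matrix.diagonal_apply_eq, Pi.mul_apply]
    rw [this]
    exact meromorphicOrderAt_mul_of_ne_zero analyticAt_const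
      (ofReal_ne_zero.mpr (hγ i).ne')
  constructor
  · rintro ⟨i, j, hij⟩
    rcases eq_or_ne i j with rfl | hne
    · exact ⟨i, by rwa [IsPole, hdiag] at hij⟩
    · exfalso
      have : (fun z => normalizedAgents w g z i j) = fun _ => 0 := by
        ext z
        rw [normalizedAgents_eq_diagonal hγ, Matrix.diagonal_apply_ne _ hne]
      rw [IsPole, this] at hij
      exact hij.not_ge (analyticAt_const.meromorphicOrderAt_nonneg)
  · rintro ⟨i, hi⟩
    exact ⟨i, i, by rwa [IsPole, hdiag]⟩

lemma sum_mem_scaledFieldOfValues (hγ : ∀ i, 0 < gamma w i) (s : ℂ) {θ : Fin n → ℝ}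
    (hθ : ∀ i, 0 ≤ θ i) (hpos : 0 < ∑ i, θ i) :
    ∑ i, (θ i : ℂ) * (gamma w i * g i s) ∈
      scaledFieldOfValues (∑ i, θ i) (normalizedAgents w g s) := by
  set α := ∑ i, θ i with hα
  have hαC : (α : ℂ) ≠ 0 := ofReal_ne_zero.mpr hpos.ne'
  have hsq : ∀ i, ((√(θ i / α) : ℝ) : ℂ) * ((√(θ i / α) : ℝ) : ℂ) = (θ i : ℂ) / α := fun i => by
    rw [← ofReal_mul, Real.mul_self_sqrt (div_nonneg (hθ i) hpos.le), ofReal_div]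
  refine ⟨_, ⟨fun i => ((√(θ i / α) : ℝ) : ℂ), ?_, rfl⟩, ?_⟩
  · simp only [dotProduct, Pi.star_apply, RCLike.star_def, conj_ofReal, hsq]
    rw [← Finset.sum_div, ← ofReal_sum, ← hα, div_self hαC]
  · rw [normalizedAgents_eq_diagonal hγ]
    simp only [dotProduct, Pi.star_apply, RCLike.star_def, conj_ofReal, Matrix.mulVec_diagonal]
    rw [Finset.mul_sum]
    refine Finset.sum_congr rfl fun i _ => ?_
    have h := hsq i
    field_simp at h
    linear_combination -(gamma w i * g i s) * h

lemma StaysAwayAlong.exists_avoidsBy (hγ : ∀ i, 0 < gamma w i) {l : Filter ℂ}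
    (h : StaysAwayAlong (normalizedAgents w g) l) :
    ∃ δ, 0 < δ ∧ ∀ᶠ s in l, AvoidsBy w (fun i => g i s) δ := by
  obtain ⟨δ, hδ, h⟩ := h
  refine ⟨min δ 1, lt_min hδ one_pos, h.mono fun s hs θ hθ hθ1 => ?_⟩
  rcases (Finset.sum_nonneg fun i _ => hθ i).eq_or_lt with h0 | hpos
  · have : ∀ i, θ i = 0 := fun i =>
      (Finset.sum_eq_zero_iff_of_nonneg fun i _ => hθ i).mp h0.symm i (Finset.mem_univ i)
    simp [this]
  · refine (min_le_left _ _).trans ?_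
    have := hs _ ⟨hpos, hθ1⟩ _ (sum_mem_scaledFieldOfValues hγ s hθ hpos)
    rwa [sub_neg_eq_add, add_comm] at this

lemma one_add_sum_ne_zero_of_notMem (hγ : ∀ i, 0 < gamma w i) {s : ℂ}
    (h : ∀ α ∈ Ioc (0 : ℝ) 1, (-1 : ℂ) ∉ scaledFieldOfValues α (normalizedAgents w g s))
    {θ : Fin n → ℝ} (hθ : ∀ i, 0 ≤ θ i) (hθ1 : ∑ i, θ i ≤ 1) :
    1 + ∑ i, (θ i : ℂ) * (gamma w i * g i s) ≠ 0 := by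
  rcases (Finset.sum_nonneg fun i _ => hθ i).eq_or_lt with h0 | hpos
  · have : ∀ i, θ i = 0 := fun i =>
      (Finset.sum_eq_zero_iff_of_nonneg fun i _ => hθ i).mp h0.symm i (Finset.mem_univ i)
    simp [this]
  · intro h0
    have hmem := sum_mem_scaledFieldOfValues (g := g) hγ s hθ hpos
    rw [eq_neg_of_add_eq_zero_right h0] at hmem
    exact h _ ⟨hpos, hθ1⟩ hmem

lemma IsProperTransferFunction.analyticAt {f : ℂ → ℂ} (hf : IsProperTransferFunction f) {p : ℂ}
    (hp : p ∈ closedRHP) (h : ¬ meromorphicOrderAt f p < 0) : AnalyticAt ℂ f p :=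
  (hf.meromorphic hp).meromorphicOrderAt_nonneg_iff_analyticAt.mp (not_lt.mp h)

/-! ### From the Nyquist contour to the closed right half-plane -/

lemma FieldOfValuesCriterion.one_add_sum_ne_zero (hγ : ∀ i, 0 < gamma w i)
    (hg : ∀ i, IsProperTransferFunction (g i))
    (hpoles : ∀ s : ℂ, 0 < s.re → ¬ IsMatrixPole (normalizedAgents w g) s)
    (hfov : FieldOfValuesCriterion (normalizedAgents w g)) {s : ℂ} (hs : s ∈ closedRHP)
    (hsp : ¬ IsMatrixPole (normalizedAgents w g) s) {θ : Fin n → ℝ} (hθ : ∀ i, 0 ≤ θ i)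
    (hθ1 : ∑ i, θ i ≤ 1) : 1 + ∑ i, (θ i : ℂ) * (gamma w i * g i s) ≠ 0 := by
  have hre : 0 ≤ s.re := hs
  have hsp' := hsp
  rw [isMatrixPole_normalizedAgents_iff hγ] at hsp'
  push Not at hsp'
  -- the imaginary-axis poles keep a positive distance from `s`
  obtain ⟨ε₀, hε₀, hfar⟩ : ∃ ε₀ > 0, ∀ p : ℂ, p.re = 0 →
      IsMatrixPole (normalizedAgents w g) p → ε₀ ≤ ‖s - p‖ := by
    have h1 : ∀ᶠ z in 𝓝 s, ∀ i, AnalyticAt ℂ (g i) z := eventually_all.mpr fun i =>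
      ((hg i).analyticAt hs (hsp' i).not_gt).eventually_analyticAt
    obtain ⟨ε₀, hε₀, hball⟩ := Metric.eventually_nhds_iff.mp h1
    refine ⟨ε₀, hε₀, fun p hp hpole => ?_⟩
    by_contra! hlt
    obtain ⟨i, hi⟩ := (isMatrixPole_normalizedAgents_iff hγ).mp hpole
    refine hi.not_ge (hball ?_ i).meromorphicOrderAt_nonneg
    rwa [dist_comm, dist_eq]
  have hR : ∀ᶠ q : ℝ × ℝ in atTop ×ˢ 𝓝[>] 0, ‖s‖ < q.1 :=
    tendsto_fst.eventually (eventually_gt_atTop _)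
  have hε : ∀ᶠ q : ℝ × ℝ in atTop ×ˢ 𝓝[>] 0, 0 < q.2 ∧ q.2 < ε₀ :=
    tendsto_snd.eventually (Ioo_mem_nhdsGT hε₀)
  obtain ⟨⟨R, ε⟩, hcon, hsR, hε0, hεε⟩ := (hfov.contour.and (hR.and hε)).exists
  dsimp only at hcon hsR hε0 hεε
  set U : Set ℂ := {z | 0 < z.re ∧ ‖z‖ < R ∧ ∀ p : ℂ, p.re = 0 →
    IsMatrixPole (normalizedAgents w g) p → ε < ‖z - p‖} with hU
  have hfront : ∀ z ∈ frontier U, ∀ ϑ : Fin n → ℝ, (∀ i, 0 ≤ ϑ i) → ∑ i, ϑ i ≤ 1 →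
      1 + ∑ i, (ϑ i : ℂ) * (gamma w i * g i z) ≠ 0 := fun z hz ϑ h0 h1 =>
    one_add_sum_ne_zero_of_notMem hγ (fun α hα => (hcon α hα).1 z hz) h0 h1
  rcases hre.eq_or_lt with him | hpos
  · -- on the imaginary axis, `s` lies on the contour itself
    refine hfront s ⟨?_, fun hint => (interior_subset hint).1.ne him⟩ θ hθ hθ1
    have hray : Tendsto (fun ρ : ℝ => s + ρ * 1) (𝓝[>] 0) (𝓝 s) :=
      (tendsto_add_mul_nhdsWithin hs (by simp) one_ne_zero).mono_right nhdsWithin_le_nhds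
    refine mem_closure_of_tendsto hray ?_
    filter_upwards [self_mem_nhdsWithin,
      hray.eventually (continuous_norm.continuousAt.eventually_lt_const hsR)] with ρ hρ hρR
    have hρ : 0 < ρ := hρ
    refine ⟨by simpa [← him] using hρ, hρR, fun p hp hpole => ?_⟩
    refine (hεε.trans_le (hfar p hp hpole)).trans_le ?_
    rw [norm_def, norm_def]
    refine Real.sqrt_le_sqrt ?_
    simp only [normSq_apply, sub_re, sub_im, add_re, add_im, re_ofReal_mul, im_ofReal_mul,
      one_re, one_im, hp, ← him]
    nlinarith
  · -- inside the contour, the maximum principle applies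
    have hclos : ∀ z ∈ closure U, z ∈ closedRHP ∧
        ¬ IsMatrixPole (normalizedAgents w g) z := by
      intro z hz
      have hz0 : z ∈ closedRHP := closure_minimal (fun u hu => (show (0 : ℝ) ≤ u.re from hu.1.le))
        (isClosed_le continuous_const continuous_re) hz
      refine ⟨hz0, fun hpole => ?_⟩
      rcases (show (0 : ℝ) ≤ z.re from hz0).eq_or_lt with h0 | hz1
      · have : z ∈ {u : ℂ | ε ≤ ‖u - z‖} :=
          closure_minimal (fun u hu => (hu.2.2 z h0.symm hpole).le)
            (isClosed_le continuous_const (continuous_id.sub continuous_const).norm) hz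
        simp only [mem_ofPred_eq, sub_self, norm_zero] at this
        exact this.not_gt hε0
      · exact hpoles z hz1 hpole
    set f : ℂ → ℂ := fun z => ∑ i, (θ i : ℂ) * (gamma w i * g i z) with hf
    have hdiff : ∀ z ∈ closure U, DifferentiableAt ℂ f z := by
      intro z hz
      obtain ⟨hz0, hzp⟩ := hclos z hz
      rw [isMatrixPole_normalizedAgents_iff hγ] at hzp
      push Not at hzp
      refine DifferentiableAt.fun_sum fun i _ => DifferentiableAt.const_mul
        (DifferentiableAt.const_mul ?_ _) _
      exact ((hg i).analyticAt hz0 (hzp i).not_gt).differentiableAt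
    have hsU : s ∈ U := ⟨hpos, hsR, fun p hp hpole => hεε.trans_le (hfar p hp hpole)⟩
    have hUb : Bornology.IsBounded U :=
      Metric.isBounded_ball.subset fun z hz => mem_ball_zero_iff.mpr hz.2.1
    have := ne_ofReal_of_forall_frontier hUb (f := f)
      ⟨fun z hz => (hdiff z (subset_closure hz)).differentiableWithinAt,
        fun z hz => (hdiff z hz).continuousAt.continuousWithinAt⟩ (fun z hz x hx hzx => ?_)
      (subset_closure hsU) le_rfl
    · intro h0
      apply this
      rw [ofReal_neg, ofReal_one]
      exact eq_neg_of_add_eq_zero_right h0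
    · -- rescaling the weights moves a value `x ≤ -1` to `-1`
      have hx0 : 0 ≤ -x⁻¹ := by
        rw [neg_nonneg, inv_nonpos]; linarith
      have hx1 : -x⁻¹ ≤ 1 := by
        rw [← inv_neg]; exact inv_le_one_of_one_le₀ (by linarith)
      have hxC : (x : ℂ) ≠ 0 := ofReal_ne_zero.mpr (by linarith)
      refine hfront z hz (fun i => -x⁻¹ * θ i) (fun i => mul_nonneg hx0 (hθ i)) ?_ ?_
      · rw [← Finset.mul_sum]
        exact mul_le_one₀ hx1 (Finset.sum_nonneg fun i _ => hθ i) hθ1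
      · have : ∑ i, (((-x⁻¹ * θ i : ℝ)) : ℂ) * (gamma w i * g i z) = -(x : ℂ)⁻¹ * f z := by
          rw [hf, Finset.mul_sum]
          refine Finset.sum_congr rfl fun i _ => ?_
          push_cast
          ring
        rw [this, hzx, neg_mul, inv_mul_cancel₀ hxC, add_neg_cancel]

/-! ### Bounds near the points of the closed right half-plane -/

/-- Along `l`, `y` and `u` are the outputs and inputs of the agents in the loop with constant
excitation `v`. -/
def SolvesLoop (w : Fin n → Fin n → ℝ) (g : Fin n → ℂ → ℂ) (l : Filter ℂ) (v : Fin n → ℂ)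
    (y u : ℂ → Fin n → ℂ) : Prop :=
  ∀ᶠ s in l, y s + network w *ᵥ u s = v ∧ ∀ i, u s i = g i s * y s i

lemma exists_bound_mul {l : Filter ℂ} {a f : ℂ → ℂ} {c : ℂ} (ha : Tendsto a l (𝓝 c))
    (hf : ∃ C : ℝ, ∀ᶠ s in l, ‖f s‖ ≤ C) : ∃ C : ℝ, ∀ᶠ s in l, ‖a s * f s‖ ≤ C := by
  obtain ⟨C, hC⟩ := hf
  refine ⟨(‖c‖ + 1) * C, ?_⟩
  filter_upwards [hC, ha.norm.eventually_lt_const (lt_add_one _)] with s h1 h2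
  rw [norm_mul]
  exact mul_le_mul h2.le h1 (norm_nonneg _) (by positivity)

lemma tendsto_inv_of_pole {f : ℂ → ℂ} {p : ℂ} (hf : meromorphicOrderAt f p < 0) :
    Tendsto (fun s => (f s)⁻¹) (𝓝[closedRHP \ {p}] p) (𝓝 0) :=
  tendsto_inv₀_cobounded.comp ((tendsto_cobounded_of_meromorphicOrderAt_neg hf).mono_left
    (nhdsWithin_closedRHP_le_nhdsNE p))

lemma eventually_ne_zero_of_pole {f : ℂ → ℂ} {p : ℂ} (hf : meromorphicOrderAt f p < 0) :
    ∀ᶠ s in 𝓝[closedRHP \ {p}] p, f s ≠ 0 :=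
  ((tendsto_cobounded_of_meromorphicOrderAt_neg hf).mono_left
    (nhdsWithin_closedRHP_le_nhdsNE p)).eventually_ne_cobounded 0

/-- The local bound at a point where not all agents have a pole. The unknowns `r` are the inputs
of the agents with a pole and the outputs of the others, and the matrix of the loop equations in
these unknowns converges to an invertible one. -/
lemma exists_bound_of_not_all_poles (hg : ∀ i, IsProperTransferFunction (g i)) {p : ℂ}
    (hp : p ∈ closedRHP) {P : Fin n → Prop} [DecidablePred P]
    (hP : ∀ i, P i ↔ meromorphicOrderAt (g i) p < 0)
    (hdet : (Matrix.diagonal (fun i => if P i then (0 : ℂ) else 1) +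
      network w * Matrix.diagonal (fun i => if P i then (1 : ℂ) else g i p)).det ≠ 0)
    {v : Fin n → ℂ} {y u : ℂ → Fin n → ℂ}
    (h : SolvesLoop w g (𝓝[closedRHP \ {p}] p) v y u) (i : Fin n) :
    (∃ C : ℝ, ∀ᶠ s in 𝓝[closedRHP \ {p}] p, ‖y s i‖ ≤ C) ∧
      ∃ C : ℝ, ∀ᶠ s in 𝓝[closedRHP \ {p}] p, ‖u s i‖ ≤ C := by
  set l := 𝓝[closedRHP \ {p}] p
  set A : ℂ → Fin n → ℂ := fun s i => if P i then (g i s)⁻¹ else 1 with hA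
  set B : ℂ → Fin n → ℂ := fun s i => if P i then 1 else g i s with hB
  set r : ℂ → Fin n → ℂ := fun s i => if P i then u s i else y s i with hr
  have hAlim : Tendsto A l (𝓝 fun i => if P i then (0 : ℂ) else 1) := by
    refine tendsto_pi_nhds.mpr fun i => ?_
    by_cases hi : P i
    · simpa only [hA, if_pos hi] using tendsto_inv_of_pole ((hP i).mp hi)
    · simpa only [hA, if_neg hi] using tendsto_const_nhds
  have hBlim : Tendsto B l (𝓝 fun i => if P i then (1 : ℂ) else g i p) := by
    refine tendsto_pi_nhds.mpr fun i => ?_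
    by_cases hi : P i
    · simpa only [hB, if_pos hi] using tendsto_const_nhds
    · simpa only [hB, if_neg hi] using ((hg i).analyticAt hp
        (mt (hP i).mpr hi)).continuousAt.tendsto.mono_left nhdsWithin_le_nhds
  have hK : Tendsto (fun s => Matrix.diagonal (A s) + network w * Matrix.diagonal (B s)) l
      (𝓝 (Matrix.diagonal (fun i => if P i then (0 : ℂ) else 1) +
        network w * Matrix.diagonal (fun i => if P i then (1 : ℂ) else g i p))) :=
    (((continuous_id.matrix_diagonal).tendsto _).comp hAlim).add
      (((continuous_const.matrix_mul continuous_id.matrix_diagonal).tendsto _).comp hBlim)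
  have hne : ∀ᶠ s in l, ∀ i, P i → g i s ≠ 0 := eventually_all.mpr fun i => by
    by_cases hi : P i
    · exact (eventually_ne_zero_of_pole ((hP i).mp hi)).mono fun s hs _ => hs
    · exact Eventually.of_forall fun s hs => absurd hs hi
  have hyr : ∀ᶠ s in l, (∀ i, y s i = A s i * r s i) ∧ ∀ i, u s i = B s i * r s i := by
    filter_upwards [h, hne] with s hs hs0
    refine ⟨fun i => ?_, fun i => ?_⟩ <;> by_cases hi : P i
    · simp only [hA, hr, if_pos hi]
      rw [hs.2 i, inv_mul_cancel_left₀ (hs0 i hi)]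
    · simp only [hA, hr, if_neg hi, one_mul]
    · simp only [hB, hr, if_pos hi, one_mul]
    · simp only [hB, hr, if_neg hi]
      exact hs.2 i
  have hrb := exists_bound_of_tendsto hK hdet (r := r) (v := v) (by
    filter_upwards [h, hyr] with s hs hs'
    rw [Matrix.add_mulVec, ← Matrix.mulVec_mulVec, ← hs.1]
    congr 2
    · ext i
      rw [Matrix.mulVec_diagonal, hs'.1]
    · ext i
      rw [Matrix.mulVec_diagonal, hs'.2]) i
  constructor
  · obtain ⟨C, hC⟩ := exists_bound_mul ((tendsto_pi_nhds.mp hAlim) i) hrb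
    exact ⟨C, by filter_upwards [hC, hyr] with s h1 h2; rwa [h2.1]⟩
  · obtain ⟨C, hC⟩ := exists_bound_mul ((tendsto_pi_nhds.mp hBlim) i) hrb
    exact ⟨C, by filter_upwards [hC, hyr] with s h1 h2; rwa [h2.2]⟩

/-- The local bound at a common pole of all agents. The outputs sum to zero, so the inputs have
weighted mean zero for the weights `1 / g i`; adding this equation to the loop equations makes
the limiting matrix invertible. -/
lemma exists_bound_of_all_poles (hw : IsConnectedNetwork w) {p : ℂ}
    (hP : ∀ i, meromorphicOrderAt (g i) p < 0) {β : Fin n → ℂ} (hβ : ∑ i, β i = 1)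
    (hlim : ∀ i, Tendsto (fun s => (g i s)⁻¹ / ∑ j, (g j s)⁻¹) (𝓝[≠] p) (𝓝 (β i)))
    {m : Fin n → ℂ} {y u : ℂ → Fin n → ℂ}
    (h : SolvesLoop w g (𝓝[closedRHP \ {p}] p) (network w *ᵥ m) y u) (i : Fin n) :
    (∃ C : ℝ, ∀ᶠ s in 𝓝[closedRHP \ {p}] p, ‖y s i‖ ≤ C) ∧
      ∃ C : ℝ, ∀ᶠ s in 𝓝[closedRHP \ {p}] p, ‖u s i‖ ≤ C := by
  set l := 𝓝[closedRHP \ {p}] p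
  have hAlim : Tendsto (fun s i => (g i s)⁻¹) l (𝓝 (0 : Fin n → ℂ)) :=
    tendsto_pi_nhds.mpr fun i => tendsto_inv_of_pole (hP i)
  have hβlim : Tendsto (fun s i => (g i s)⁻¹ / ∑ j, (g j s)⁻¹) l (𝓝 β) :=
    tendsto_pi_nhds.mpr fun i => (hlim i).mono_left (nhdsWithin_closedRHP_le_nhdsNE p)
  have hrow : Continuous fun b : Fin n → ℂ => (Matrix.of fun (_ : Fin n) i => b i) :=
    continuous_matrix fun _ j => continuous_apply j
  have hK : Tendsto (fun s => Matrix.diagonal (fun i => (g i s)⁻¹) + (network w +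
      Matrix.of fun (_ : Fin n) i => (g i s)⁻¹ / ∑ j, (g j s)⁻¹)) l
      (𝓝 (Matrix.diagonal (0 : Fin n → ℂ) + (network w + Matrix.of fun _ i => β i))) :=
    (((continuous_id.matrix_diagonal).tendsto _).comp hAlim).add
      (tendsto_const_nhds.add ((hrow.tendsto β).comp hβlim))
  have hne : ∀ᶠ s in l, ∀ i, g i s ≠ 0 :=
    eventually_all.mpr fun i => eventually_ne_zero_of_pole (hP i)
  have hyu : ∀ᶠ s in l, ∀ i, y s i = (g i s)⁻¹ * u s i := by
    filter_upwards [h, hne] with s hs hs0 i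
    rw [hs.2 i, inv_mul_cancel_left₀ (hs0 i)]
  have hub := exists_bound_of_tendsto hK (by
    rw [show Matrix.diagonal (0 : Fin n → ℂ) = 0 from Matrix.diagonal_zero, zero_add]
    exact det_network_add_replicate_ne_zero hw hβ) (r := u) (v := network w *ᵥ m) (by
    filter_upwards [h, hyu] with s hs hs'
    have hsum : ∑ i, (g i s)⁻¹ * u s i = 0 := by
      have := congrArg (fun z => ∑ i, z i) hs.1
      simp only [Pi.add_apply, Finset.sum_add_distrib, sum_network_mulVec hw, add_zero] at this
      rw [← this]
      exact Finset.sum_congr rfl fun i _ => (hs' i).symm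
    rw [Matrix.add_mulVec, Matrix.add_mulVec, ← hs.1]
    ext k
    have hmean : ((Matrix.of fun (_ : Fin n) i => (g i s)⁻¹ / ∑ j, (g j s)⁻¹) *ᵥ u s) k = 0 := by
      simp only [Matrix.mulVec, dotProduct, Matrix.of_apply, div_mul_eq_mul_div]
      rw [← Finset.sum_div, hsum, zero_div]
    rw [Pi.add_apply, Pi.add_apply, Pi.add_apply, hmean, Matrix.mulVec_diagonal, hs' k,
      add_zero]) i
  refine ⟨?_, hub⟩
  obtain ⟨C, hC⟩ := exists_bound_mul ((tendsto_pi_nhds.mp hAlim) i) hub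
  exact ⟨C, by filter_upwards [hC, hyu] with s h1 h2; rwa [h2]⟩

lemma IsProperTransferFunction.apply_ofReal {f : ℂ → ℂ} (hf : IsProperTransferFunction f)
    {x : ℝ} (hx : 0 ≤ x) : f x = ((f x).re : ℂ) := by
  refine (conj_eq_iff_re.mp ?_).symm
  rw [← hf.real _ (show (0 : ℝ) ≤ (x : ℂ).re from hx), conj_ofReal]

/-- On the positive real axis the criterion is the one-sided bound `-1 < γ i * g i`. -/
lemma FieldOfValuesCriterion.neg_one_lt (hγ : ∀ i, 0 < gamma w i)
    (hg : ∀ i, IsProperTransferFunction (g i))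
    (hpoles : ∀ s : ℂ, 0 < s.re → ¬ IsMatrixPole (normalizedAgents w g) s)
    (hfov : FieldOfValuesCriterion (normalizedAgents w g)) {x : ℝ} (hx : 0 < x) (i : Fin n) :
    -1 < gamma w i * (g i x).re := by
  by_contra! hle
  set t := gamma w i * (g i x).re with ht
  have ht0 : t ≠ 0 := by linarith
  have hx' : 0 < (x : ℂ).re := hx
  refine hfov.one_add_sum_ne_zero hγ hg hpoles (show (0 : ℝ) ≤ (x : ℂ).re from hx'.le)
    (hpoles x hx') (θ := Pi.single i (-t⁻¹)) ?_ ?_ ?_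
  · intro j
    rcases eq_or_ne j i with rfl | hj
    · rw [Pi.single_eq_same, neg_nonneg, inv_nonpos]
      linarith
    · rw [Pi.single_eq_of_ne hj]
  · rw [Finset.sum_pi_single', if_pos (Finset.mem_univ i), ← inv_neg]
    exact inv_le_one_of_one_le₀ (by linarith)
  · rw [Finset.sum_eq_single i (fun j _ hj => by rw [Pi.single_eq_of_ne hj]; simp)
      (fun hi => absurd (Finset.mem_univ i) hi), Pi.single_eq_same, (hg i).apply_ofReal hx.le,
      ← ofReal_mul, ← ht, ← ofReal_mul, neg_mul, inv_mul_cancel₀ ht0]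
    simp

/-- At an imaginary-axis pole, the limits of the agents without a pole satisfy the criterion for
weights with sum less than one. At the origin, where the criterion gives no uniform bound, this is
a consequence of the reality of the transfer functions. -/
lemma FieldOfValuesCriterion.limit_ne_zero (hγ : ∀ i, 0 < gamma w i)
    (hg : ∀ i, IsProperTransferFunction (g i))
    (hpoles : ∀ s : ℂ, 0 < s.re → ¬ IsMatrixPole (normalizedAgents w g) s)
    (hfov : FieldOfValuesCriterion (normalizedAgents w g)) {p : ℂ} (hp : p.re = 0)
    (hpole : IsMatrixPole (normalizedAgents w g) p) {θ : Fin n → ℝ} (hθ : ∀ i, 0 ≤ θ i)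
    (hθP : ∀ i, meromorphicOrderAt (g i) p < 0 → θ i = 0) (hθ1 : ∑ i, θ i < 1) :
    1 + ∑ i, (θ i : ℂ) * (gamma w i * g i p) ≠ 0 := by
  have hpR : p ∈ closedRHP := show (0 : ℝ) ≤ p.re from hp.ge
  rcases eq_or_ne p 0 with rfl | hp0
  · have hreal : ∀ i, g i 0 = ((g i 0).re : ℂ) := fun i => by
      simpa using (hg i).apply_ofReal le_rfl
    have hlow : ∀ i, θ i * -1 ≤ θ i * (gamma w i * (g i 0).re) := by
      intro i
      by_cases hi : meromorphicOrderAt (g i) 0 < 0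
      · rw [hθP i hi, zero_mul, zero_mul]
      refine mul_le_mul_of_nonneg_left ?_ (hθ i)
      have hcont : Tendsto (fun x : ℝ => gamma w i * (g i x).re) (𝓝[>] 0)
          (𝓝 (gamma w i * (g i 0).re)) := by
        have h1 : Tendsto (fun x : ℝ => (x : ℂ)) (𝓝[>] 0) (𝓝 0) := by
          have := (continuous_ofReal.tendsto 0).mono_left (nhdsWithin_le_nhds (s := Ioi 0))
          rwa [ofReal_zero] at this
        exact ((continuous_re.tendsto _).comp
          (((hg i).analyticAt hpR hi).continuousAt.tendsto.comp h1)).const_mul _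
      refine ge_of_tendsto hcont ?_
      filter_upwards [self_mem_nhdsWithin] with x hx
      exact (hfov.neg_one_lt hγ hg hpoles hx i).le
    have hsum : 1 + ∑ i, (θ i : ℂ) * (gamma w i * g i 0) =
        ((1 + ∑ i, θ i * (gamma w i * (g i 0).re) : ℝ) : ℂ) := by
      push_cast
      congr 1
      exact Finset.sum_congr rfl fun i _ => by rw [← hreal i]
    rw [hsum, ofReal_ne_zero]
    have := Finset.sum_le_sum fun i (_ : i ∈ Finset.univ) => hlow i
    rw [← Finset.sum_mul] at this
    linarith
  · obtain ⟨δ, hδ, hav⟩ := (hfov.indentation p hp hp0 hpole).exists_avoidsBy hγ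
    have hlim : Tendsto (fun s => ‖1 + ∑ i, (θ i : ℂ) * (gamma w i * g i s)‖)
        (𝓝[closedRHP \ {p}] p) (𝓝 ‖1 + ∑ i, (θ i : ℂ) * (gamma w i * g i p)‖) := by
      refine (tendsto_const_nhds.add (tendsto_finsetSum _ fun i _ => ?_)).norm
      by_cases hi : meromorphicOrderAt (g i) p < 0
      · simp only [hθP i hi, ofReal_zero, zero_mul]
        exact tendsto_const_nhds
      · exact (((hg i).analyticAt hpR hi).continuousAt.tendsto.mono_left
          nhdsWithin_le_nhds).const_mul _ |>.const_mul _
    have := neBot_nhdsWithin_closedRHP hpR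
    have hge := ge_of_tendsto hlim (hav.mono fun s hs => hs θ hθ hθ1.le)
    exact norm_pos_iff.mp (hδ.trans_le hge)

/-- At a common imaginary-axis pole of all agents, the inverses of the agents do not cancel. At
the origin they are positive on the positive real axis; elsewhere they have simple zeros, with
derivatives of positive real part. -/
lemma FieldOfValuesCriterion.exists_tendsto_ratio [Nonempty (Fin n)] (hγ : ∀ i, 0 < gamma w i)
    (hg : ∀ i, IsProperTransferFunction (g i))
    (hpoles : ∀ s : ℂ, 0 < s.re → ¬ IsMatrixPole (normalizedAgents w g) s)
    (hfov : FieldOfValuesCriterion (normalizedAgents w g)) {p : ℂ} (hp : p.re = 0)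
    (hP : ∀ i, meromorphicOrderAt (g i) p < 0) :
    ∃ β : Fin n → ℂ, ∑ i, β i = 1 ∧
      ∀ i, Tendsto (fun s => (g i s)⁻¹ / ∑ j, (g j s)⁻¹) (𝓝[≠] p) (𝓝 (β i)) := by
  have hpR : p ∈ closedRHP := show (0 : ℝ) ≤ p.re from hp.ge
  rcases eq_or_ne p 0 with rfl | hp0
  · refine exists_tendsto_ratio_of_pos (a := fun i s => (g i s)⁻¹) hpR
      (fun i => ((hg i).meromorphic.meromorphicOn _ hpR).inv) (eventually_all.mpr fun i => ?_)
    have hray : Tendsto (fun x : ℝ => (0 : ℂ) + x * 1) (𝓝[>] 0) (𝓝[≠] 0) :=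
      (tendsto_add_mul_nhdsWithin hpR (by simp) one_ne_zero).mono_right
        (nhdsWithin_closedRHP_le_nhdsNE 0)
    have hbig := (tendsto_norm_atTop_iff_cobounded.mpr
      ((tendsto_cobounded_of_meromorphicOrderAt_neg (hP i)).comp hray)).eventually_gt_atTop
        (gamma w i)⁻¹
    filter_upwards [hbig, self_mem_nhdsWithin] with x hx hx0
    have hx0 : 0 < x := hx0
    have hlow := hfov.neg_one_lt hγ hg hpoles hx0 i
    have hre := (hg i).apply_ofReal hx0.le
    simp only [Function.comp_apply, zero_add, mul_one] at hx ⊢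
    rw [hre, norm_real, Real.norm_eq_abs] at hx
    have hpos : 0 < (g i x).re := by
      by_contra! hneg
      rw [abs_of_nonpos hneg, inv_lt_iff_one_lt_mul₀ (hγ i)] at hx
      linarith
    exact ⟨((g i x).re)⁻¹, inv_pos.mpr hpos, by rw [hre, ofReal_inv, ofReal_re]⟩
  · have hpole : IsMatrixPole (normalizedAgents w g) p :=
      (isMatrixPole_normalizedAgents_iff hγ).mpr ⟨Classical.arbitrary _, hP _⟩
    obtain ⟨δ, hδ, hav⟩ := (hfov.indentation p hp hp0 hpole).exists_avoidsBy hγ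
    have hsimple := fun i => exists_simple_pole hpR (hP i) (hγ i) hδ (by
      filter_upwards [hav] with s hs α hα
      have := hs (Pi.single i (α / gamma w i)) (fun j => ?_) ?_
      · rw [Finset.sum_eq_single i (fun j _ hj => by rw [Pi.single_eq_of_ne hj]; simp)
          (fun hi => absurd (Finset.mem_univ i) hi), Pi.single_eq_same, ← mul_assoc,
          ← ofReal_mul, div_mul_cancel₀ _ (hγ i).ne'] at this
        exact this
      · rcases eq_or_ne j i with rfl | hj
        · rw [Pi.single_eq_same]
          exact div_nonneg hα.1.le (hγ j).le
        · rw [Pi.single_eq_of_ne hj]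
      · rw [Finset.sum_pi_single', if_pos (Finset.mem_univ i)]
        exact (div_le_one (hγ i)).mpr hα.2)
    choose e he hre hge using hsimple
    have hepos : ∀ i, 0 < ((e i p)⁻¹).re := fun i => by
      rw [inv_re]
      refine div_pos (hre i) (normSq_pos.mpr fun h0 => ?_)
      have := hre i
      rw [h0, zero_re] at this
      exact this.false
    have hene : ∀ i, e i p ≠ 0 := fun i h0 => by
      have := hepos i
      simp [h0] at this
    have hsum : ∑ j, (e j p)⁻¹ ≠ 0 := fun h0 => by
      have h1 := Finset.sum_pos (fun j (_ : j ∈ Finset.univ) => hepos j) Finset.univ_nonempty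
      rw [← re_sum, h0, zero_re] at h1
      exact h1.false
    refine ⟨fun i => (e i p)⁻¹ / ∑ j, (e j p)⁻¹, ?_, fun i => ?_⟩
    · rw [← Finset.sum_div, div_self hsum]
    · have hinv : ∀ j, Tendsto (fun s => (e j s)⁻¹) (𝓝[≠] p) (𝓝 (e j p)⁻¹) := fun j =>
        ((he j).inv₀ (hene j)).tendsto.mono_left nhdsWithin_le_nhds
      refine ((hinv i).div (tendsto_finsetSum _ fun j _ => hinv j) hsum).congr' ?_
      filter_upwards [eventually_all.mpr hge, self_mem_nhdsWithin] with s hs hsp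
      have hsp0 : s - p ≠ 0 := sub_ne_zero.mpr hsp
      simp only [Pi.div_apply, hs, mul_inv, inv_inv, ← Finset.mul_sum]
      rw [mul_div_mul_left _ _ hsp0]

/-- The inputs and outputs of the agents in a loop with excitation in the range of `L` are bounded
near every point of the closed right half-plane. -/
lemma FieldOfValuesCriterion.exists_bound (hw : IsConnectedNetwork w) (hγ : ∀ i, 0 < gamma w i)
    (hg : ∀ i, IsProperTransferFunction (g i))
    (hpoles : ∀ s : ℂ, 0 < s.re → ¬ IsMatrixPole (normalizedAgents w g) s)
    (hfov : FieldOfValuesCriterion (normalizedAgents w g)) {p : ℂ} (hp : p ∈ closedRHP)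
    {m : Fin n → ℂ} {y u : ℂ → Fin n → ℂ}
    (h : SolvesLoop w g (𝓝[closedRHP \ {p}] p) (network w *ᵥ m) y u) (i : Fin n) :
    (∃ C : ℝ, ∀ᶠ s in 𝓝[closedRHP \ {p}] p, ‖y s i‖ ≤ C) ∧
      ∃ C : ℝ, ∀ᶠ s in 𝓝[closedRHP \ {p}] p, ‖u s i‖ ≤ C := by
  classical
  by_cases hpole : IsMatrixPole (normalizedAgents w g) p
  · have hre : p.re = 0 := le_antisymm (not_lt.mp fun h0 => hpoles p h0 hpole) hp
    by_cases hall : ∀ i, meromorphicOrderAt (g i) p < 0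
    · have : Nonempty (Fin n) := ⟨i⟩
      obtain ⟨β, hβ, hlim⟩ := hfov.exists_tendsto_ratio hγ hg hpoles hre hall
      exact exists_bound_of_all_poles hw hall hβ hlim h i
    · push Not at hall
      refine exists_bound_of_not_all_poles hg hp (fun _ => Iff.rfl) ?_ h i
      exact det_limit_ne_zero hw hγ ((isMatrixPole_normalizedAgents_iff hγ).mp hpole)
        (hall.imp fun _ => not_lt.mpr) fun θ h0 hP h1 =>
          hfov.limit_ne_zero hγ hg hpoles hre hpole h0 hP h1
  · have hnone := hpole
    rw [isMatrixPole_normalizedAgents_iff hγ] at hnone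
    refine exists_bound_of_not_all_poles hg hp (P := fun _ => False)
      (fun i => ⟨False.elim, fun hi => hnone ⟨i, hi⟩⟩) ?_ h i
    simp only [if_false, Matrix.diagonal_one]
    exact det_one_add_network_mul_diagonal_ne_zero hw hγ fun θ h0 h1 =>
      hfov.one_add_sum_ne_zero hγ hg hpoles hp hpole h0 h1

/-- The same bound near infinity, where the agents are bounded and the criterion is uniform. -/
lemma FieldOfValuesCriterion.exists_bound_infinity (hw : IsConnectedNetwork w)
    (hγ : ∀ i, 0 < gamma w i) (hg : ∀ i, IsProperTransferFunction (g i))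
    (hfov : FieldOfValuesCriterion (normalizedAgents w g)) {m : Fin n → ℂ}
    {y u : ℂ → Fin n → ℂ}
    (h : SolvesLoop w g (Bornology.cobounded ℂ ⊓ 𝓟 closedRHP) (network w *ᵥ m) y u)
    (i : Fin n) :
    (∃ C : ℝ, ∀ᶠ s in Bornology.cobounded ℂ ⊓ 𝓟 closedRHP, ‖y s i‖ ≤ C) ∧
      ∃ C : ℝ, ∀ᶠ s in Bornology.cobounded ℂ ⊓ 𝓟 closedRHP, ‖u s i‖ ≤ C := by
  obtain ⟨δ, hδ, hav⟩ := hfov.infinity.exists_avoidsBy hγ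
  have hy : ∀ᶠ s in Bornology.cobounded ℂ ⊓ 𝓟 closedRHP,
      ‖y s i‖ ≤ √(gamma w i) * ((∑ j, √(gamma w j) * ‖m j‖) / δ) := by
    filter_upwards [hav, h] with s hs hs'
    refine norm_le_of_avoidsBy hw hγ hδ hs (y := y s) ?_ i
    rw [← hs'.1]
    congr 2
    ext j
    exact (hs'.2 j).symm
  refine ⟨⟨_, hy⟩, ?_⟩
  obtain ⟨C, R, hC⟩ := (hg i).proper
  have hgC : ∀ᶠ s in Bornology.cobounded ℂ ⊓ 𝓟 closedRHP, ‖g i s‖ ≤ C := by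
    rw [eventually_inf_principal, ← comap_norm_atTop]
    filter_upwards [(tendsto_comap (f := (norm : ℂ → ℝ))).eventually (eventually_ge_atTop R)]
      with s hs hs'
    exact hC s hs' hs
  refine ⟨C * (√(gamma w i) * ((∑ j, √(gamma w j) * ‖m j‖) / δ)), ?_⟩
  filter_upwards [hy, hgC, h] with s h1 h2 h3
  rw [h3.2, norm_mul]
  exact mul_le_mul h2 h1 (norm_nonneg _) ((norm_nonneg _).trans h2)

/-! ### The closed loop -/

lemma eventually_not_isMatrixPole (hγ : ∀ i, 0 < gamma w i)
    (hg : ∀ i, IsProperTransferFunction (g i)) {p : ℂ} (hp : p ∈ closedRHP) :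
    ∀ᶠ s in 𝓝[≠] p, ¬ IsMatrixPole (normalizedAgents w g) s := by
  have h : ∀ᶠ s in 𝓝[≠] p, ∀ i, AnalyticAt ℂ (g i) s := eventually_all.mpr fun i =>
    ((hg i).meromorphic.meromorphicOn p hp).eventually_analyticAt
  filter_upwards [h] with s hs
  rw [isMatrixPole_normalizedAgents_iff hγ]
  rintro ⟨i, hi⟩
  exact hi.not_ge (hs i).meromorphicOrderAt_nonneg

lemma eventually_cobounded_not_isMatrixPole (hγ : ∀ i, 0 < gamma w i)
    (hg : ∀ i, IsProperTransferFunction (g i)) :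
    ∀ᶠ s in Bornology.cobounded ℂ ⊓ 𝓟 closedRHP,
      ¬ IsMatrixPole (normalizedAgents w g) s := by
  have h : ∀ᶠ s in Bornology.cobounded ℂ ⊓ 𝓟 closedRHP, ∀ i,
      ¬ meromorphicOrderAt (g i) s < 0 := eventually_all.mpr fun i => by
    obtain ⟨C, R, hC⟩ := (hg i).proper
    rw [eventually_inf_principal, ← comap_norm_atTop]
    filter_upwards [(tendsto_comap (f := (norm : ℂ → ℝ))).eventually (eventually_gt_atTop R)]
      with s hs hsR
    have := neBot_nhdsWithin_closedRHP hsR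
    refine not_lt.mpr (meromorphicOrderAt_nonneg_of_bounded (C := C)
      (nhdsWithin_closedRHP_le_nhdsNE s) ?_)
    filter_upwards [self_mem_nhdsWithin,
      nhdsWithin_le_nhds (continuous_norm.continuousAt.eventually_const_lt hs)] with z hz hzR
    exact hC z hz.1 hzR.le
  filter_upwards [h] with s hs
  rw [isMatrixPole_normalizedAgents_iff hγ]
  rintro ⟨i, hi⟩
  exact hs i hi

lemma FieldOfValuesCriterion.det_ne_zero (hw : IsConnectedNetwork w) (hγ : ∀ i, 0 < gamma w i)
    (hg : ∀ i, IsProperTransferFunction (g i))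
    (hpoles : ∀ s : ℂ, 0 < s.re → ¬ IsMatrixPole (normalizedAgents w g) s)
    (hfov : FieldOfValuesCriterion (normalizedAgents w g)) {s : ℂ} (hs : s ∈ closedRHP)
    (hsp : ¬ IsMatrixPole (normalizedAgents w g) s) :
    (1 + agents g s * network w).det ≠ 0 := by
  have h := det_one_add_network_mul_diagonal_ne_zero hw hγ fun θ h0 h1 =>
    hfov.one_add_sum_ne_zero hγ hg hpoles hs hsp h0 h1
  rwa [← Matrix.det_one_add_mul_comm] at h

lemma vecMul_disturbanceResponse_apply (v : Fin n → ℂ) (s : ℂ) (i : Fin n) :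
    (v ᵥ* disturbanceResponse w g s) i = g i s * (v ᵥ* outputSensitivity w g s) i := by
  rw [disturbanceResponse, ← Matrix.vecMul_vecMul, agents, Matrix.vecMul_diagonal, mul_comm]

/-- The modes solve the loop equations. -/
lemma vecMul_outputSensitivity_add (hw : IsConnectedNetwork w) {s : ℂ}
    (hs : (1 + agents g s * network w).det ≠ 0) (v : Fin n → ℂ) :
    v ᵥ* outputSensitivity w g s + network w *ᵥ (v ᵥ* disturbanceResponse w g s) = v := by
  have h : v ᵥ* outputSensitivity w g s ᵥ* (1 + agents g s * network w) = v := by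
    rw [Matrix.vecMul_vecMul, outputSensitivity,
      Matrix.nonsing_inv_mul _ (isUnit_iff_ne_zero.mpr hs), Matrix.vecMul_one]
  conv_rhs => rw [← h]
  rw [Matrix.vecMul_add, Matrix.vecMul_one, ← Matrix.vecMul_vecMul, disturbanceResponse,
    ← Matrix.vecMul_vecMul]
  congr 1
  conv_lhs => rw [← network_transpose hw, Matrix.mulVec_transpose]

lemma meromorphicOn_det {A : ℂ → Matrix (Fin n) (Fin n) ℂ} {U : Set ℂ}
    (hA : ∀ i j, MeromorphicOn (fun s => A s i j) U) : MeromorphicOn (fun s => (A s).det) U := by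
  intro p hp
  simp only [Matrix.det_apply, Units.smul_def, zsmul_eq_mul]
  exact MeromorphicAt.fun_sum fun σ _ => (MeromorphicAt.const _ p).mul
    (MeromorphicAt.fun_prod fun i _ => hA _ _ p hp)

lemma meromorphicOn_vecMul_outputSensitivity (hg : ∀ i, IsProperTransferFunction (g i))
    (v : Fin n → ℂ) (j : Fin n) :
    MeromorphicOn (fun s => (v ᵥ* outputSensitivity w g s) j) closedRHP := by
  have hM : ∀ i j, MeromorphicOn (fun s => (1 + agents g s * network w) i j) closedRHP := by
    intro i j p hp
    simp only [agents, Matrix.add_apply, Matrix.diagonal_mul]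
    exact (MeromorphicAt.const _ p).add
      (((hg i).meromorphic.meromorphicOn p hp).mul (MeromorphicAt.const _ p))
  have hinv : ∀ i, MeromorphicOn (fun s => outputSensitivity w g s i j) closedRHP := by
    intro i
    simp only [outputSensitivity, Matrix.inv_def, Ring.inverse_eq_inv', Matrix.smul_apply,
      smul_eq_mul, Matrix.adjugate_apply]
    intro p hp
    refine ((meromorphicOn_det hM p hp).inv).mul (meromorphicOn_det (fun a b => ?_) p hp)
    rcases eq_or_ne a j with rfl | ha
    · simp only [Matrix.updateRow_self]
      exact MeromorphicOn.const _
    · simp only [Matrix.updateRow_ne ha]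
      exact hM a b
  intro p hp
  simp only [Matrix.vecMul, dotProduct]
  exact MeromorphicAt.fun_sum fun i _ => (MeromorphicAt.const _ p).mul (hinv i p hp)

/-- Without lines all eigenvalues of the Laplacian vanish, so there are no interarea modes. -/
lemma asymptoticallySynchronizes_of_network_eq_zero (hL : network w = 0) :
    AsymptoticallySynchronizes w g := by
  refine ⟨by simp [hL], fun v μ hμ hv j => ?_⟩
  have hlap : laplacian w = 0 := by
    ext i k
    simpa [network] using congrFun (congrFun hL i) k
  have hv0 : v = 0 := by
    rw [hlap, Matrix.zero_mulVec, eq_comm, smul_eq_zero] at hv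
    exact hv.resolve_left hμ
  have hzero : IsStable fun _ => 0 :=
    ⟨fun _ => 0, analyticOnNhd_const, ⟨0, by simp⟩, EventuallyEq.rfl⟩
  have hvC : (fun i => ((v i : ℝ) : ℂ)) = 0 := by
    ext i
    simp [hv0]
  simp only [hvC, Matrix.zero_vecMul, Pi.zero_apply]
  exact ⟨hzero, hzero⟩

lemma FieldOfValuesCriterion.asymptoticallySynchronizes (hw : IsConnectedNetwork w)
    (hγ : ∀ i, 0 < gamma w i) (hg : ∀ i, IsProperTransferFunction (g i))
    (hpoles : ∀ s : ℂ, 0 < s.re → ¬ IsMatrixPole (normalizedAgents w g) s)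
    (hfov : FieldOfValuesCriterion (normalizedAgents w g)) : AsymptoticallySynchronizes w g := by
  have hdet : ∀ p ∈ closedRHP, ∀ᶠ s in 𝓝[closedRHP \ {p}] p,
      (1 + agents g s * network w).det ≠ 0 := fun p hp => by
    filter_upwards [(eventually_not_isMatrixPole hγ hg hp).filter_mono
      (nhdsWithin_closedRHP_le_nhdsNE p), self_mem_nhdsWithin] with s hs hsR
    exact hfov.det_ne_zero hw hγ hg hpoles hsR.1 hs
  refine ⟨?_, fun v μ hμ hv j => ?_⟩
  · simp only [codiscreteWithin, eventually_iSup]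
    exact hdet
  -- an interarea mode is an excitation in the range of the Laplacian
  set vC : Fin n → ℂ := fun i => (v i : ℂ) with hvC
  have hrange : network w *ᵥ (fun i => (v i : ℂ) / μ) = vC := by
    ext i
    have h := congrArg (fun x : ℝ => (x : ℂ)) (congrFun hv i)
    simp only [Matrix.mulVec, dotProduct, Pi.smul_apply, smul_eq_mul, ofReal_sum,
      ofReal_mul] at h
    have hμC : (μ : ℂ) ≠ 0 := ofReal_ne_zero.mpr hμ
    simp only [Matrix.mulVec, dotProduct, network, Matrix.map_apply, ← mul_div_assoc]
    rw [← Finset.sum_div, h, mul_div_cancel_left₀ _ hμC]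
  have hsol : ∀ s, (1 + agents g s * network w).det ≠ 0 →
      vC ᵥ* outputSensitivity w g s + network w *ᵥ (vC ᵥ* disturbanceResponse w g s) =
        network w *ᵥ (fun i => (v i : ℂ) / μ) ∧
      ∀ i, (vC ᵥ* disturbanceResponse w g s) i = g i s * (vC ᵥ* outputSensitivity w g s) i :=
    fun s hs => ⟨by rw [hrange]; exact vecMul_outputSensitivity_add hw hs vC,
      vecMul_disturbanceResponse_apply vC s⟩
  have hloc := fun p (hp : p ∈ closedRHP) => hfov.exists_bound hw hγ hg hpoles hp
    (y := fun s => vC ᵥ* outputSensitivity w g s) (u := fun s => vC ᵥ* disturbanceResponse w g s)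
    ((hdet p hp).mono hsol) j
  have hinf := hfov.exists_bound_infinity hw hγ hg
    (y := fun s => vC ᵥ* outputSensitivity w g s) (u := fun s => vC ᵥ* disturbanceResponse w g s)
    (by
      filter_upwards [eventually_cobounded_not_isMatrixPole hγ hg,
        mem_inf_of_right (mem_principal_self closedRHP)] with s hs hsR
      exact hsol s (hfov.det_ne_zero hw hγ hg hpoles hsR hs)) j
  have hmero := meromorphicOn_vecMul_outputSensitivity (w := w) hg vC j
  refine ⟨isStable_of_bounded ?_ (fun p hp => (hloc p hp).2) hinf.2,
    isStable_of_bounded hmero (fun p hp => (hloc p hp).1) hinf.1⟩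
  simp only [vecMul_disturbanceResponse_apply]
  exact fun p hp => ((hg j).meromorphic.meromorphicOn p hp).mul (hmero p hp)

end Criterion

end ScalableNyquist

theorem mainTheorem2 (n : ℕ) (w : Fin n → Fin n → ℝ) (g : Fin n → ℂ → ℂ)
    (hw : ScalableNyquist.IsConnectedNetwork w)
    (hg : ∀ i, ScalableNyquist.IsProperTransferFunction (g i))
    (hpoles : ∀ s : ℂ, 0 < s.re →
      ¬ ScalableNyquist.IsMatrixPole (ScalableNyquist.normalizedAgents w g) s)
    (hfov : ScalableNyquist.FieldOfValuesCriterion (ScalableNyquist.normalizedAgents w g)) :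
    ScalableNyquist.AsymptoticallySynchronizes w g := by
  rcases hw.gamma_pos_or_network_eq_zero with hγ | hL
  · exact hfov.asymptoticallySynchronizes hw hγ hg hpoles
  · exact ScalableNyquist.asymptoticallySynchronizes_of_network_eq_zero hL
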